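/- Let $\Phi_W=\{x_i\}_i$ (Wi-Fi access points, APs) and $\Phi_L=\{y_k\}_k$ (LTE base stations, eNBs) be independent homogeneous Poisson point processes on $\mathbb{R}^2$ with intensities $\lambda_W,\lambda_L>0$. APs and eNBs transmit with powers $P_W,P_L>0$; the path loss at distance $d$ is $\ell(d)=(4\pi/\lambda_c)^2 d^{\alpha}$ with wavelength $\lambda_c>0$ and exponent $\alpha>0$; the sensing thresholds are $\Gamma_{cs},\Gamma_{ed}>0$ (used by APs for APs and eNBs, respectively) and $\Gamma^L>0$ (used by eNBs). Every AP and every eNB carries a back-off timer, $t_i^W$ for AP $x_i$ and $t_k^L$ for eNB $y_k$, uniformly distributed on $[0,1]$; the fading variables $G_{ji}^{W}$ (channel from AP $x_j$ to AP $x_i$), $G_{mi}^{LW}$ (eNB $y_m$ to AP $x_i$), $G_{jk}^{WL}$ (AP $x_j$ to eNB $y_k$), $G_{mk}^{L}$ (eNB $y_m$ to eNB $y_k$) are exponentially distributed with parameter $\mu>0$. All timers and fading variables are mutually independent and independent of $(\Phi_W,\Phi_L)$. The medium access indicators under listen-before-talk with random back-off on the contention window $(a,b)=(0,1)$ are $$e_i^W=\prod_{x_j\in\Phi_W\setminus\{x_i\}}\Bigl(\mathbf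 1_{t_j^W\ge t_i^W}+\mathbf 1_{t_j^W<t_i^W}\mathbf 1_{G_{ji}^W/\ell(\|x_j-x_i\|)\le\Gamma_{cs}/P_W}\Bigr)\prod_{y_m\in\Phi_L}\Bigl(\mathbf 1_{t_m^L\ge t_i^W}+\mathbf 1_{t_m^L<t_i^W}\mathbf 1_{G_{mi}^{LW}/\ell(\|y_m-x_i\|)\le\Gamma_{ed}/P_L}\Bigr),$$ $$e_k^L=\prod_{x_j\in\Phi_W}\Bigl(\mathbf 1_{t_j^W\ge t_k^L}+\mathbf 1_{t_j^W<t_k^L}\mathbf 1_{G_{jk}^{WL}/\ell(\|x_j-y_k\|)\le\Gamma^L/P_W}\Bigr)\prod_{y_m\in\Phi_L\setminus\{y_k\}}\Bigl(\mathbf 1_{t_m^L\ge t_k^L}+\mathbf 1_{t_m^L<t_k^L}\mathbf 1_{G_{mk}^{L}/\ell(\|y_m-y_k\|)\le\Gamma^L/P_L}\Bigr).$$ The medium access probability (MAP) of the typical AP (resp. eNB) is the Palm probability that its indicator equals $1$, i.e. for a Borel set $B\subset\mathbb{R}^2$ with $0<|B|<\infty$, $$p^W_{3,\mathrm{MAP}}=\frac{1}{\lambda_W|B|}\,\mathbb{E}\sum_{x_i\in\Phi_W\cap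 B}\mathbf 1_{e_i^W=1},\qquad p^L_{3,\mathrm{MAP}}=\frac{1}{\lambda_L|B|}\,\mathbb{E}\sum_{y_k\in\Phi_L\cap B}\mathbf 1_{e_k^L=1}.$$ Put $$N_3^W(\Gamma)=\lambda_W\int_{\mathbb{R}^2}e^{-\mu\frac{\Gamma}{P_W}\ell(\|x\|)}\,dx,\quad N_3^L(\Gamma)=\lambda_L\int_{\mathbb{R}^2}e^{-\mu\frac{\Gamma}{P_L}\ell(\|x\|)}\,dx,\quad N^W=N_3^W(\Gamma_{cs}),\quad N^L=N_3^L(\Gamma_{ed}).$$ Then, for every such $B$, $$p^{W}_{3,\mathrm{MAP}}=\frac{1-\exp(-N^W-N^L)}{N^W+N^L},\qquad p^{L}_{3,\mathrm{MAP}}=\frac{1-\exp\bigl(-N^W_3(\Gamma^{L})-N^L_3(\Gamma^{L})\bigr)}{N^W_3(\Gamma^{L})+N^L_3(\Gamma^{L})}.$$ -/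

import Mathlib

open MeasureTheory ProbabilityTheory
open scoped ENNReal

noncomputable section

namespace Coexistence

/-- The Euclidean plane `ℝ²`. -/
abbrev Plane : Type := EuclideanSpace ℝ (Fin 2)

/-! ### System parameters -/

/-- Parameters of the Wi-Fi / LTE system, on a linear scale. -/
structure Params where
  /-- intensity of the Wi-Fi access points (APs) -/
  lamW : ℝ
  /-- intensity of the LTE eNodeBs (eNBs) -/
  lamL : ℝ
  /-- transmit power of the APs -/
  PW : ℝ
  /-- transmit power of the eNBs -/
  PL : ℝ
  /-- Wi-Fi carrier sensing threshold -/
  Γcs : ℝ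
  /-- Wi-Fi energy detection threshold -/
  Γed : ℝ
  /-- LTE sensing threshold -/
  ΓL : ℝ
  /-- parameter of the exponentially distributed (Rayleigh) fading variables -/
  μ : ℝ
  /-- path loss exponent -/
  α : ℝ
  /-- carrier wavelength -/
  lamC : ℝ
  lamW_pos : 0 < lamW
  lamL_pos : 0 < lamL
  PW_pos : 0 < PW
  PL_pos : 0 < PL
  Γcs_pos : 0 < Γcs
  Γed_pos : 0 < Γed
  ΓL_pos : 0 < ΓL
  μ_pos : 0 < μ
  α_pos : 0 < α
  lamC_pos : 0 < lamC

namespace Params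

variable (q : Params)

/-- Free space path loss with reference distance one meter. In decibel this is
`20 log₁₀ (4π / λ_c) + 10 α log₁₀ d`. -/
def pathLoss (d : ℝ) : ℝ := (4 * Real.pi / q.lamC) ^ 2 * d ^ q.α

/-- `N₀^W(y, r, Γ)`: mean number of APs outside the closed ball `B(0, r)` whose power received
at `y` exceeds `Γ`. -/
def NW0 (y : Plane) (r Γ : ℝ) : ℝ :=
  q.lamW * ∫ x in (Metric.closedBall (0 : Plane) r)ᶜ,
    Real.exp (-(q.μ * (Γ / q.PW) * q.pathLoss ‖x - y‖))

/-- `N₀^L(y, r, Γ)`: mean number of eNBs outside the closed ball `B(0, r)` whose power received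
at `y` exceeds `Γ`. -/
def NL0 (y : Plane) (r Γ : ℝ) : ℝ :=
  q.lamL * ∫ x in (Metric.closedBall (0 : Plane) r)ᶜ,
    Real.exp (-(q.μ * (Γ / q.PL) * q.pathLoss ‖x - y‖))

/-- `N₃^W(Γ)` -/
def NW3 (Γ : ℝ) : ℝ := q.NW0 0 0 Γ

/-- `N₃^L(Γ)` -/
def NL3 (Γ : ℝ) : ℝ := q.NL0 0 0 Γ

/-- `N^W` -/
def NW : ℝ := q.NW0 0 0 q.Γcs

/-- `N^L` -/
def NL : ℝ := q.NL0 0 0 q.Γed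

end Params

/-! ### Point processes -/

/-- The number `Φ(B)` of points of `Φ = {x i}` that lie in `B`, counted with multiplicity. -/
def pointCount {Ω : Type*} (x : ℕ → Ω → Plane) (B : Set Plane) (ω : Ω) : ℝ≥0∞ :=
  ∑' i, B.indicator 1 (x i ω)

/-- `Φ = {x i}` (in a measurable enumeration) is a homogeneous Poisson point process on the plane
with intensity `lam`. As `lam > 0` in all uses, `Φ` is almost surely infinite, so that it can be
enumerated by `ℕ`. -/
structure IsHomogeneousPPP {Ω : Type*} [MeasurableSpace Ω] (P : Measure Ω)
    (x : ℕ → Ω → Plane) (lam : ℝ) : Prop where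
  measurable : ∀ i, Measurable (x i)
  /-- the number of points in a region is Poisson with mean `lam` times the area -/
  count_law : ∀ B : Set Plane, MeasurableSet B → volume B ≠ ∞ →
    HasLaw (pointCount x B)
      ((poissonMeasure (lam * volume.real B).toNNReal).map (fun n : ℕ => (n : ℝ≥0∞))) P
  /-- the numbers of points in disjoint regions are independent -/
  count_indep : ∀ (n : ℕ) (B : Fin n → Set Plane), (∀ k, MeasurableSet (B k)) →
    Pairwise (fun k l => Disjoint (B k) (B l)) →
    iIndepFun (fun k => pointCount x (B k)) P

/-- The Palm probability that the typical point of a stationary process `Φ = {x i}` of intensity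
`lam` has property `E`, where `E i` is the event that the point `x i` has the property, computed
with the test region `B`:
`(lam |B|)⁻¹ 𝔼 [∑_{x i ∈ B} 1_{E i}]`. -/
def palmProb {Ω : Type*} [MeasurableSpace Ω] (P : Measure Ω) (x : ℕ → Ω → Plane) (lam : ℝ)
    (E : ℕ → Set Ω) (B : Set Plane) : ℝ≥0∞ :=
  (∫⁻ ω, ∑' i, (x i ⁻¹' B ∩ E i).indicator 1 ω ∂P) / (ENNReal.ofReal lam * volume B)

/-! ### The network -/

/-- Labels of the random marks of the network. -/
inductive Mark : Type
  /-- back-off timer of AP `i` -/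
  | timerW (i : ℕ)
  /-- back-off timer of eNB `k` -/
  | timerL (k : ℕ)
  /-- fading of the channel from AP `j` to AP `i` -/
  | fadeW (j i : ℕ)
  /-- fading of the channel from eNB `m` to AP `i` -/
  | fadeLW (m i : ℕ)
  /-- fading of the channel from AP `j` to eNB `k` -/
  | fadeWL (j k : ℕ)
  /-- fading of the channel from eNB `m` to eNB `k` -/
  | fadeL (m k : ℕ)

/-- The random objects of the network: the APs `x i`, the eNBs `y k`, and all marks. -/
structure Network (Ω : Type*) where
  x : ℕ → Ω → Plane
  y : ℕ → Ω → Plane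
  mark : Mark → Ω → ℝ

/-- The probabilistic model when LTE uses listen-before-talk with random back-off timers
that are uniform on `[a, b]`: two independent homogeneous Poisson processes, whose points carry
mutually independent back-off timers and fading variables. -/
structure IsLBTModel {Ω : Type*} [MeasurableSpace Ω] (P : Measure Ω) (q : Params) (a b : ℝ)
    (net : Network Ω) : Prop where
  ppp_x : IsHomogeneousPPP P net.x q.lamW
  ppp_y : IsHomogeneousPPP P net.y q.lamL
  indep_xy : IndepFun (fun ω i => net.x i ω) (fun ω k => net.y k ω) P
  measurable_mark : ∀ m, Measurable (net.mark m)
  iIndep_mark : iIndepFun net.mark P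
  indep_points_mark : IndepFun (fun ω => ((fun i => net.x i ω), (fun k => net.y k ω)))
    (fun ω m => net.mark m ω) P
  timerW_law : ∀ i, pdf.IsUniform (net.mark (.timerW i)) (Set.Icc 0 1) P
  timerL_law : ∀ k, pdf.IsUniform (net.mark (.timerL k)) (Set.Icc a b) P
  fadeW_law : ∀ j i, HasLaw (net.mark (.fadeW j i)) (expMeasure q.μ) P
  fadeLW_law : ∀ m i, HasLaw (net.mark (.fadeLW m i)) (expMeasure q.μ) P
  fadeWL_law : ∀ j k, HasLaw (net.mark (.fadeWL j k)) (expMeasure q.μ) P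
  fadeL_law : ∀ m k, HasLaw (net.mark (.fadeL m k)) (expMeasure q.μ) P

/-- The transmitter with timer `t'` does not block the node with timer `t`: either its timer is
not smaller, or it is smaller but the received power `pow * G / pl` is at most `Γ`, where `G` is
the fading and `pl` the path loss of the channel. As an indicator this is
`1_{t' ≥ t} + 1_{t' < t} 1_{G / pl ≤ Γ / pow}`. -/
def NotBlocked (t' t G pl Γ pow : ℝ) : Prop :=
  t' ≥ t ∨ (t' < t ∧ G / pl ≤ Γ / pow)

/-- The event `e_i^W = 1` that AP `i` gets channel access: the product of the indicators
of not being blocked by any other AP (threshold `Γcs`) or any eNB (threshold `Γed`) is one. -/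
def accessW {Ω : Type*} (q : Params) (net : Network Ω) (i : ℕ) : Set Ω :=
  {ω | (∀ j, j ≠ i → NotBlocked (net.mark (.timerW j) ω) (net.mark (.timerW i) ω)
          (net.mark (.fadeW j i) ω) (q.pathLoss ‖net.x j ω - net.x i ω‖) q.Γcs q.PW) ∧
       (∀ m, NotBlocked (net.mark (.timerL m) ω) (net.mark (.timerW i) ω)
          (net.mark (.fadeLW m i) ω) (q.pathLoss ‖net.y m ω - net.x i ω‖) q.Γed q.PL)}

/-- The event `e_k^L = 1` that eNB `k` gets channel access: the product of the indicators
of not being blocked by any AP or any other eNB (common threshold `ΓL`) is one. -/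
def accessL {Ω : Type*} (q : Params) (net : Network Ω) (k : ℕ) : Set Ω :=
  {ω | (∀ j, NotBlocked (net.mark (.timerW j) ω) (net.mark (.timerL k) ω)
          (net.mark (.fadeWL j k) ω) (q.pathLoss ‖net.x j ω - net.y k ω‖) q.ΓL q.PW) ∧
       (∀ m, m ≠ k → NotBlocked (net.mark (.timerL m) ω) (net.mark (.timerL k) ω)
          (net.mark (.fadeL m k) ω) (q.pathLoss ‖net.y m ω - net.y k ω‖) q.ΓL q.PL)}

end Coexistence

end

open Coexistence

-- Fix the positions of all transmitters and the timer value `s` of the typical node. Another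
-- transmitter at displacement `z ≠ 0` blocks it with probability `s * exp (-c ℓ(‖z‖))`: `s` is the
-- chance of a smaller timer, the exponential the chance of fading strong enough to be sensed. These
-- events are independent over the transmitters, so access has the probability of an infinite
-- product over the points (`measure_access`). By Campbell-Mecke and Slivnyak, the Poisson process
-- seen from its typical point is the same process with that point added, and the Laplace functional
-- turns the product into `exp (-s (N₁ + N₂))`. Integrating over `s ∈ [0, 1]` gives the formula
-- (`palmProb_access`), which serves both kinds of node.
--
-- The processes are given only by the laws and the independence of the counts of an enumerated
-- sequence, so the Poisson formulas are derived from these. For simple `f`, the product of the `f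
-- (x j)` is a product of powers `v ^ N` of independent Poisson counts; approximation yields the
-- Laplace functional, jointly with the count of a set on which `f = 1` (`lintegral_mul_infProd`).
-- For the Mecke formula (`lintegral_tsum_infProd`) the plane is cut into finitely many cells and
-- points in the cell of the typical point are ignored, so that the cell count factors off. As the
-- cells are refined, only points at the same position stay ignored, and for those the true factor
-- is `g 0 = 1`. Simplicity of the process is thus never needed.

section

open Filter Topology Set

-- Infinite products with factors in `[0, 1]`.

/-- The infinite product of a sequence of factors in `[0, 1]`. -/
noncomputable def infProd (f : ℕ → ℝ≥0∞) : ℝ≥0∞ := ⨅ n, ∏ j ∈ Finset.range n, f j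

theorem antitone_prod_range {f : ℕ → ℝ≥0∞} (hf : ∀ j, f j ≤ 1) :
    Antitone fun n => ∏ j ∈ Finset.range n, f j := by
  refine antitone_nat_of_succ_le fun n => ?_
  rw [Finset.prod_range_succ]
  exact mul_le_of_le_one_right' (hf n)

theorem tendsto_infProd {f : ℕ → ℝ≥0∞} (hf : ∀ j, f j ≤ 1) :
    Tendsto (fun n => ∏ j ∈ Finset.range n, f j) atTop (𝓝 (infProd f)) :=
  tendsto_atTop_iInf (antitone_prod_range hf)

theorem infProd_le_one (f : ℕ → ℝ≥0∞) : infProd f ≤ 1 :=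
  (iInf_le _ 0).trans (by simp)

theorem infProd_mul {f g : ℕ → ℝ≥0∞} (hf : ∀ j, f j ≤ 1) (hg : ∀ j, g j ≤ 1) :
    infProd (fun j => f j * g j) = infProd f * infProd g := by
  refine tendsto_nhds_unique (tendsto_infProd fun j => mul_le_one' (hf j) (hg j)) ?_
  simp_rw [Finset.prod_mul_distrib]
  exact ENNReal.Tendsto.mul (tendsto_infProd hf)
    (.inr ((infProd_le_one g).trans_lt ENNReal.one_lt_top).ne) (tendsto_infProd hg)
    (.inr ((infProd_le_one f).trans_lt ENNReal.one_lt_top).ne)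

theorem infProd_eq_prod {f : ℕ → ℝ≥0∞} (hf : ∀ j, f j ≤ 1) (s : Finset ℕ)
    (hs : ∀ j ∉ s, f j = 1) : infProd f = ∏ j ∈ s, f j := by
  refine tendsto_nhds_unique (tendsto_infProd hf) (tendsto_const_nhds.congr' ?_)
  obtain ⟨N, hN⟩ := s.exists_nat_subset_range
  filter_upwards [eventually_ge_atTop N] with n hn
  exact Finset.prod_subset (hN.trans (Finset.range_mono hn)) fun j _ hj => hs j hj

theorem infProd_one : infProd (fun _ => 1) = 1 := by simp [infProd]

theorem infProd_finset_prod {κ : Type*} (s : Finset κ) {f : κ → ℕ → ℝ≥0∞}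
    (hf : ∀ k j, f k j ≤ 1) :
    infProd (fun j => ∏ k ∈ s, f k j) = ∏ k ∈ s, infProd (f k) := by
  classical
  induction s using Finset.induction_on with
  | empty => simp [infProd_one]
  | insert a s ha ih =>
    simp_rw [Finset.prod_insert ha]
    rw [infProd_mul (hf a) (fun j => Finset.prod_le_one' fun k _ => hf k j), ih]

theorem measurable_infProd {α : Type*} [MeasurableSpace α] {f : ℕ → α → ℝ≥0∞}
    (hf : ∀ j, Measurable (f j)) : Measurable fun a => infProd fun j => f j a :=
  Measurable.iInf fun _ => Finset.measurable_fun_prod _ fun j _ => hf j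

/-- Both limits are infima and hence commute; for a fixed number of factors, continuity of
multiplication at finite values suffices. -/
theorem infProd_antitone_iInf {f : ℕ → ℕ → ℝ≥0∞} (hf : ∀ n j, f n j ≤ 1)
    (hanti : Antitone f) : ⨅ n, infProd (f n) = infProd fun j => ⨅ n, f n j := by
  unfold infProd
  rw [iInf_comm]
  refine iInf_congr fun m => ?_
  refine tendsto_nhds_unique (tendsto_atTop_iInf fun a b hab =>
    Finset.prod_le_prod' fun j _ => hanti hab j) ?_
  induction m with
  | zero => simp
  | succ m ih =>
    simp_rw [Finset.prod_range_succ]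
    have h1 : ∏ j ∈ Finset.range m, ⨅ n, f n j ≠ ∞ :=
      ((Finset.prod_le_one' fun j _ => (iInf_le _ 0).trans (hf 0 j)).trans_lt
        ENNReal.one_lt_top).ne
    have h2 : ⨅ n, f n m ≠ ∞ := (((iInf_le _ 0).trans (hf 0 m)).trans_lt ENNReal.one_lt_top).ne
    exact ENNReal.Tendsto.mul ih (.inr h2)
      (tendsto_atTop_iInf fun a b hab => hanti hab m) (.inr h1)

/-- Infinitely many factors may move with `n`; monotonicity replaces any uniform control of the
tail. -/
theorem tendsto_infProd_of_antitone {f : ℕ → ℕ → ℝ≥0∞} {g : ℕ → ℝ≥0∞} (hf : ∀ n j, f n j ≤ 1)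
    (hanti : ∀ j, Antitone fun n => f n j) (hlim : ∀ j, Tendsto (fun n => f n j) atTop (𝓝 (g j))) :
    Tendsto (fun n => infProd (f n)) atTop (𝓝 (infProd g)) := by
  have h1 : Antitone f := fun m n hmn j => hanti j hmn
  have h2 : g = fun j => ⨅ n, f n j := by
    ext j
    exact tendsto_nhds_unique (hlim j) (tendsto_atTop_iInf (hanti j))
  rw [h2, ← infProd_antitone_iInf hf h1]
  exact tendsto_atTop_iInf fun m n hmn => iInf_mono fun k =>
    Finset.prod_le_prod' fun j _ => h1 hmn j

/-! ### Poisson distribution -/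

theorem lintegral_poissonMeasure (r : NNReal) (f : ℕ → ℝ≥0∞) :
    ∫⁻ n, f n ∂(poissonMeasure r) =
      ∑' n : ℕ, f n * ENNReal.ofReal (Real.exp (-r) * r ^ n / n.factorial) := by
  rw [lintegral_countable']
  simp_rw [poissonMeasure_singleton]

theorem lintegral_natCast_poissonMeasure (r : NNReal) :
    ∫⁻ n, (n : ℝ≥0∞) ∂(poissonMeasure r) = r := by
  rw [lintegral_poissonMeasure, tsum_eq_zero_add' ENNReal.summable]
  -- The factor `1 *` lets `lintegral_poissonMeasure` refold the remaining sum as the total mass of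
  -- a Poisson law.
  have h : ∀ n : ℕ, ((n + 1 : ℕ) : ℝ≥0∞) *
      ENNReal.ofReal (Real.exp (-r) * r ^ (n + 1) / (n + 1).factorial) =
      r * (1 * ENNReal.ofReal (Real.exp (-r) * r ^ n / n.factorial)) := by
    intro n
    rw [← ENNReal.ofReal_natCast, one_mul, ← ENNReal.ofReal_coe_nnreal,
      ← ENNReal.ofReal_mul (by positivity), ← ENNReal.ofReal_mul (by positivity)]
    congr 1
    rw [Nat.factorial_succ]
    push_cast
    field_simp
    ring
  simp_rw [h]
  rw [ENNReal.tsum_mul_left, ← lintegral_poissonMeasure]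
  simp

/-- Tilting by `v ^ n` turns the weights of mean `r` into those of mean `r * v`, up to the constant
`exp (-r (1 - v))`. -/
theorem lintegral_pow_poissonMeasure (r v : NNReal) :
    ∫⁻ n, (v : ℝ≥0∞) ^ n ∂(poissonMeasure r) = ENNReal.ofReal (Real.exp (-(r * (1 - v)))) := by
  rw [lintegral_poissonMeasure]
  have h : ∀ n : ℕ, (v : ℝ≥0∞) ^ n * ENNReal.ofReal (Real.exp (-r) * r ^ n / n.factorial) =
      ENNReal.ofReal (Real.exp (-(r * (1 - v)))) *
        (1 * ENNReal.ofReal (Real.exp (-(r * v : NNReal)) * (r * v : NNReal) ^ n / n.factorial)) := by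
    intro n
    rw [one_mul, ← ENNReal.ofReal_coe_nnreal, ← ENNReal.ofReal_pow (by positivity),
      ← ENNReal.ofReal_mul (by positivity), ← ENNReal.ofReal_mul (by positivity)]
    congr 1
    have : Real.exp (-r) = Real.exp (-(r * (1 - v))) * Real.exp (-(r * v)) := by
      rw [← Real.exp_add]; ring_nf
    rw [this]
    push_cast
    ring
  simp_rw [h]
  rw [ENNReal.tsum_mul_left, ← lintegral_poissonMeasure]
  simp

/-- `exp (-lam * a)` for finite `a`. -/
noncomputable def expNeg (lam : ℝ) (a : ℝ≥0∞) : ℝ≥0∞ := ENNReal.ofReal (Real.exp (-(lam * a.toReal)))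

-- Counts of points: finiteness, moments and independence.

section PointCount

variable {Ω : Type*} {x : ℕ → Ω → Plane} {C : Set Plane} {ω : Ω}

theorem finite_of_pointCount_ne_top (h : pointCount x C ω ≠ ∞) : {j | x j ω ∈ C}.Finite := by
  refine (ENNReal.finite_const_le_of_tsum_ne_top h one_ne_zero).subset fun j hj => ?_
  simp [Set.indicator_of_mem (show x j ω ∈ C from hj)]

open Classical in
theorem infProd_ite_eq_rpow (h : pointCount x C ω ≠ ∞) {v : ℝ≥0∞} (hv : v ≤ 1) :
    infProd (fun j => if x j ω ∈ C then v else 1) = v ^ (pointCount x C ω).toReal := by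
  have hfin := finite_of_pointCount_ne_top h
  have h1 : pointCount x C ω = hfin.toFinset.card := by
    rw [pointCount, tsum_eq_sum (s := hfin.toFinset)]
    · rw [Finset.sum_congr rfl (g := fun _ => 1)]
      · simp
      · intro j hj
        have : x j ω ∈ C := by simpa using hj
        simp [this]
    · intro j hj
      have : x j ω ∉ C := by simpa using hj
      simp [this]
  rw [infProd_eq_prod (fun j => by split_ifs <;> simp [hv]) hfin.toFinset, h1,
    Finset.prod_congr rfl (g := fun _ => v)]
  · simp
  · intro j hj
    have : x j ω ∈ C := by simpa using hj
    simp [this]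
  · intro j hj
    have : x j ω ∉ C := by simpa using hj
    simp [this]

end PointCount

namespace Coexistence.IsHomogeneousPPP

variable {Ω : Type*} [MeasurableSpace Ω] {P : Measure Ω} {x : ℕ → Ω → Plane} {lam : ℝ}

theorem measurable_pointCount (h : IsHomogeneousPPP P x lam) {C : Set Plane}
    (hC : MeasurableSet C) : Measurable (pointCount x C) :=
  Measurable.tsum fun i => (measurable_one.indicator hC).comp (h.measurable i)

theorem lintegral_comp_pointCount (h : IsHomogeneousPPP P x lam) {C : Set Plane}
    (hC : MeasurableSet C) (hC' : volume C ≠ ∞) {φ : ℝ≥0∞ → ℝ≥0∞} (hφ : Measurable φ) :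
    ∫⁻ ω, φ (pointCount x C ω) ∂P =
      ∫⁻ n : ℕ, φ n ∂(poissonMeasure (lam * volume.real C).toNNReal) := by
  rw [(h.count_law C hC hC').lintegral_comp hφ.aemeasurable, lintegral_map hφ (by fun_prop)]

theorem ae_pointCount_ne_top (h : IsHomogeneousPPP P x lam) {C : Set Plane}
    (hC : MeasurableSet C) (hC' : volume C ≠ ∞) : ∀ᵐ ω ∂P, pointCount x C ω ≠ ∞ := by
  have := (h.count_law C hC hC').measure_eq (p := fun a => a = ∞) (measurableSet_singleton _)
  rw [show {a : ℝ≥0∞ | a = ∞} = {∞} from rfl, Measure.map_apply (f := fun n : ℕ => (n : ℝ≥0∞)) (by fun_prop) (measurableSet_singleton _),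
    show (fun n : ℕ => (n : ℝ≥0∞)) ⁻¹' {∞} = ∅ by ext n; simp] at this
  rw [ae_iff]
  simpa using this

theorem lintegral_pointCount (h : IsHomogeneousPPP P x lam) (hlam : 0 ≤ lam) {C : Set Plane}
    (hC : MeasurableSet C) (hC' : volume C ≠ ∞) :
    ∫⁻ ω, pointCount x C ω ∂P = ENNReal.ofReal lam * volume C := by
  rw [h.lintegral_comp_pointCount hC hC' (φ := fun a => a) measurable_id]
  simp only [lintegral_natCast_poissonMeasure]
  rw [← ENNReal.ofReal_toReal hC', ← ENNReal.ofReal_mul hlam]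
  rfl

theorem lintegral_rpow_pointCount (h : IsHomogeneousPPP P x lam) (hlam : 0 ≤ lam) {C : Set Plane}
    (hC : MeasurableSet C) (hC' : volume C ≠ ∞) {v : ℝ≥0∞} (hv : v ≤ 1) :
    ∫⁻ ω, v ^ (pointCount x C ω).toReal ∂P = expNeg lam ((1 - v) * volume C) := by
  rw [h.lintegral_comp_pointCount hC hC' (φ := fun a => v ^ a.toReal) (by fun_prop)]
  lift v to NNReal using (hv.trans_lt ENNReal.one_lt_top).ne
  simp only [ENNReal.toReal_natCast, ENNReal.rpow_natCast]
  rw [lintegral_pow_poissonMeasure, expNeg, Real.coe_toNNReal _ (by positivity), ENNReal.toReal_mul,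
    ENNReal.toReal_sub_of_le hv ENNReal.one_ne_top]
  simp only [ENNReal.toReal_one, ENNReal.coe_toReal, Measure.real]
  ring_nf

theorem lintegral_prod_comp_pointCount (h : IsHomogeneousPPP P x lam) {κ : Type*} (s : Finset κ)
    {C : κ → Set Plane} (hC : ∀ k, MeasurableSet (C k))
    (hd : (s : Set κ).Pairwise fun k l => Disjoint (C k) (C l)) {φ : κ → ℝ≥0∞ → ℝ≥0∞}
    (hφ : ∀ k, Measurable (φ k)) :
    ∫⁻ ω, ∏ k ∈ s, φ k (pointCount x (C k) ω) ∂P = ∏ k ∈ s, ∫⁻ ω, φ k (pointCount x (C k) ω) ∂P := by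
  -- `count_indep` is stated for families indexed by `Fin n`, so `s` is enumerated.
  let e := s.equivFin.symm
  have hi := h.count_indep s.card (fun a => C (e a)) (fun a => hC _) fun a b hab =>
    hd (e a).2 (e b).2 fun hne => hab (e.injective (Subtype.ext hne))
  have := lintegral_prod_eq_prod_lintegral_of_indepFun Finset.univ _
    (hi.comp (fun a => φ (e a)) fun a => hφ _)
    fun a => (hφ _).comp (h.measurable_pointCount (hC _))
  have key : ∀ g : κ → ℝ≥0∞, ∏ k ∈ s, g k = ∏ a, g (e a) := fun g => by
    rw [← Finset.prod_coe_sort, ← e.prod_comp fun k : s => g k]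
  simp_rw [key]
  exact this

end Coexistence.IsHomogeneousPPP

-- The Laplace functional of a Poisson process.

theorem expNeg_sum {κ : Type*} (lam : ℝ) (s : Finset κ) {a : κ → ℝ≥0∞} (ha : ∀ k ∈ s, a k ≠ ∞) :
    expNeg lam (∑ k ∈ s, a k) = ∏ k ∈ s, expNeg lam (a k) := by
  simp only [expNeg]
  rw [ENNReal.toReal_sum ha, ← ENNReal.ofReal_prod_of_nonneg (fun _ _ => (Real.exp_pos _).le),
    ← Real.exp_sum, Finset.mul_sum, Finset.sum_neg_distrib]

/-- Finiteness of the limit matters: `toReal` gives `expNeg lam ∞ = 1`, not `0`. -/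
theorem tendsto_expNeg (lam : ℝ) {ι : Type*} {l : Filter ι} {a : ι → ℝ≥0∞} {b : ℝ≥0∞} (hb : b ≠ ∞)
    (h : Tendsto a l (𝓝 b)) : Tendsto (fun i => expNeg lam (a i)) l (𝓝 (expNeg lam b)) :=
  ENNReal.tendsto_ofReal ((Real.continuous_exp.tendsto _).comp
    (((ENNReal.tendsto_toReal hb).comp h).const_mul lam).neg)

theorem measurable_expNeg (lam : ℝ) : Measurable (expNeg lam) := by
  unfold expNeg; fun_prop

theorem expNeg_le_one {lam : ℝ} (hlam : 0 ≤ lam) (a : ℝ≥0∞) : expNeg lam a ≤ 1 := by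
  rw [expNeg, ENNReal.ofReal_le_one, Real.exp_le_one_iff]
  have : 0 ≤ a.toReal := ENNReal.toReal_nonneg
  nlinarith [mul_nonneg hlam this]

namespace Coexistence.IsHomogeneousPPP

variable {Ω : Type*} [MeasurableSpace Ω] {P : Measure Ω} {x : ℕ → Ω → Plane} {lam : ℝ}

-- Grouping the points by the value of `f` gives a finite product of powers of counts. The level
-- sets of values other than `1` are disjoint from each other and from `A`, so all counts involved
-- are independent.
open Classical in
theorem lintegral_mul_infProd_simpleFunc (h : IsHomogeneousPPP P x lam) (hlam : 0 ≤ lam)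
    {A : Set Plane} (hA : MeasurableSet A) {w : ℝ≥0∞ → ℝ≥0∞} (hw : Measurable w)
    (f : SimpleFunc Plane ℝ≥0∞) (hf : ∀ z, f z ≤ 1) (hfv : volume {z | f z ≠ 1} ≠ ∞)
    (hfA : ∀ z ∈ A, f z = 1) :
    ∫⁻ ω, w (pointCount x A ω) * infProd (fun j => f (x j ω)) ∂P =
      (∫⁻ ω, w (pointCount x A ω) ∂P) * expNeg lam (∫⁻ z, (1 - f z)) := by
  -- The value `1` contributes nothing to the product, and its level set may have infinite area.
  set V := f.range.erase 1 with hV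
  -- The index `none` stands for the set `A` with weight `w`, and `some v` for the level set of `v`
  -- with weight `v ^ N`.
  let C : Option ℝ≥0∞ → Set Plane := fun o => o.elim A fun v => f ⁻¹' {v}
  let φ : Option ℝ≥0∞ → ℝ≥0∞ → ℝ≥0∞ := fun o => o.elim w fun v a => v ^ a.toReal
  have hC : ∀ o, MeasurableSet (C o) := by
    rintro (_ | v)
    · exact hA
    · exact f.measurableSet_preimage _
  have hφ : ∀ o, Measurable (φ o) := by
    rintro (_ | v)
    · exact hw
    · change Measurable fun a : ℝ≥0∞ => v ^ a.toReal
      fun_prop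
  have hd : ((Finset.insertNone V : Finset (Option ℝ≥0∞)) : Set (Option ℝ≥0∞)).Pairwise
      fun k l => Disjoint (C k) (C l) := by
    rintro (_ | u) hu (_ | v) hv huv
    · exact absurd rfl huv
    · refine Set.disjoint_left.2 fun z hz hz' => ?_
      have : v ≠ 1 := by
        have : v ∈ V := by simpa using hv
        exact Finset.ne_of_mem_erase this
      exact this ((show f z = v from hz') ▸ hfA z hz)
    · refine Set.disjoint_left.2 fun z hz' hz => ?_
      have : u ≠ 1 := by
        have : u ∈ V := by simpa using hu
        exact Finset.ne_of_mem_erase this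
      exact this ((show f z = u from hz') ▸ hfA z hz)
    · refine Set.disjoint_left.2 fun z hz hz' => huv ?_
      rw [← show f z = u from hz, ← show f z = v from hz']
  have hvol : ∀ v ∈ V, volume (f ⁻¹' {v}) ≠ ∞ := fun v hv =>
    measure_ne_top_of_subset (fun z (hz : f z = v) => by
      simpa [hz] using Finset.ne_of_mem_erase hv) hfv
  have hv1 : ∀ v ∈ V, v ≤ 1 := fun v hv => by
    obtain ⟨z, rfl⟩ := SimpleFunc.mem_range.1 (Finset.mem_of_mem_erase hv)
    exact hf z
  have hprod := h.lintegral_prod_comp_pointCount (Finset.insertNone V) hC hd hφ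
  have hpt : ∀ᵐ ω ∂P, infProd (fun j => f (x j ω)) =
      ∏ v ∈ V, v ^ (pointCount x (f ⁻¹' {v}) ω).toReal := by
    have : ∀ᵐ ω ∂P, ∀ v ∈ V, pointCount x (f ⁻¹' {v}) ω ≠ ∞ :=
      (ae_ball_iff V.countable_toSet).2 fun v hv =>
        h.ae_pointCount_ne_top (f.measurableSet_preimage _) (hvol v hv)
    filter_upwards [this] with ω hω
    -- Each factor becomes a product over all values, so that the infinite product can be exchanged
    -- with the finite one.
    have h1 : ∀ j, f (x j ω) = ∏ v ∈ V.attach, if x j ω ∈ f ⁻¹' {v.1} then v.1 else 1 := by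
      intro j
      rw [Finset.prod_attach V fun v => if x j ω ∈ f ⁻¹' {v} then v else 1]
      simp only [Set.mem_preimage, Set.mem_singleton_iff]
      rw [Finset.prod_ite_eq]
      by_cases h1 : f (x j ω) = 1
      · simp [h1]
      · rw [if_pos (Finset.mem_erase.2 ⟨h1, f.mem_range_self _⟩)]
    simp_rw [h1]
    rw [infProd_finset_prod _ fun v j => by split_ifs <;> simp [hv1 v.1 v.2],
      ← Finset.prod_attach V]
    exact Finset.prod_congr rfl fun v _ => infProd_ite_eq_rpow (hω v v.2) (hv1 v v.2)
  simp only [Finset.prod_insertNone] at hprod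
  rw [lintegral_congr_ae (hpt.mono fun ω hω => by rw [hω])]
  refine hprod.trans ?_
  change (∫⁻ ω, w (pointCount x A ω) ∂P) *
    ∏ v ∈ V, ∫⁻ ω, v ^ (pointCount x (f ⁻¹' {v}) ω).toReal ∂P = _
  congr 1
  rw [Finset.prod_congr rfl fun v hv => h.lintegral_rpow_pointCount hlam
    (f.measurableSet_preimage _) (hvol v hv) (hv1 v hv), ← expNeg_sum]
  · congr 1
    have : ∫⁻ z, (1 - f z) = (f.map (fun v => 1 - v)).lintegral volume := by
      rw [← SimpleFunc.lintegral_eq_lintegral]; rfl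
    rw [this, SimpleFunc.map_lintegral, hV]
    by_cases h1 : (1 : ℝ≥0∞) ∈ f.range
    · rw [← Finset.add_sum_erase _ _ h1]; simp
    · rw [Finset.erase_eq_of_notMem h1]
  · exact fun v hv => ENNReal.mul_ne_top (by simp) (hvol v hv)

theorem lintegral_mul_infProd (h : IsHomogeneousPPP P x lam) (hlam : 0 ≤ lam)
    {A : Set Plane} (hA : MeasurableSet A) {w : ℝ≥0∞ → ℝ≥0∞} (hw : Measurable w)
    (hwA : ∫⁻ ω, w (pointCount x A ω) ∂P ≠ ∞)
    {f : Plane → ℝ≥0∞} (hfm : Measurable f) (hf : ∀ z, f z ≤ 1) (hfi : ∫⁻ z, (1 - f z) ≠ ∞)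
    (hfA : ∀ z ∈ A, f z = 1) :
    ∫⁻ ω, w (pointCount x A ω) * infProd (fun j => f (x j ω)) ∂P =
      (∫⁻ ω, w (pointCount x A ω) ∂P) * expNeg lam (∫⁻ z, (1 - f z)) := by
  have hum : Measurable fun z => 1 - f z := measurable_const.sub hfm
  set u : Plane → ℝ≥0∞ := fun z => 1 - f z with hu
  -- Simple functions increasing to `1 - f`, cut off to sets of finite area; the functions `1 - g n`
  -- then satisfy the hypotheses of the simple case, including the value `1` on `A`.
  let g : ℕ → SimpleFunc Plane ℝ≥0∞ := fun n =>
    (SimpleFunc.eapprox u n).restrict (spanningSets volume n)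
  have hgapp : ∀ n z, g n z = (spanningSets volume n).indicator (SimpleFunc.eapprox u n) z :=
    fun n z => SimpleFunc.restrict_apply _ (measurableSet_spanningSets _ _) _
  have hgu : ∀ n z, g n z ≤ u z := fun n z => by
    rw [hgapp]
    exact (indicator_le_self' (fun _ _ => bot_le) z).trans
      (((SimpleFunc.iSup_eapprox_apply hum z) ▸ le_iSup (fun n => SimpleFunc.eapprox u n z) n))
  have hu1 : ∀ z, u z ≤ 1 := fun z => tsub_le_self
  have hgmono : Monotone fun n z => g n z := by
    intro m n hmn z
    simp only [hgapp]
    refine (indicator_le_indicator (SimpleFunc.monotone_eapprox u hmn z)).trans ?_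
    exact indicator_le_indicator_of_subset (monotone_spanningSets _ hmn) (fun _ => bot_le) z
  have hglim : ∀ z, Tendsto (fun n => g n z) atTop (𝓝 (u z)) := by
    intro z
    have h1 : Tendsto (fun n => SimpleFunc.eapprox u n z) atTop (𝓝 (u z)) := by
      rw [← SimpleFunc.iSup_eapprox_apply hum z]
      exact tendsto_atTop_iSup fun m n hmn => SimpleFunc.monotone_eapprox u hmn z
    refine h1.congr' ?_
    filter_upwards [eventually_ge_atTop (spanningSetsIndex volume z)] with n hn
    rw [hgapp, indicator_of_mem]
    exact monotone_spanningSets _ hn (mem_spanningSetsIndex _ z)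
  let F : ℕ → SimpleFunc Plane ℝ≥0∞ := fun n => (g n).map fun v => 1 - v
  have hF : ∀ n z, F n z = 1 - g n z := fun n z => rfl
  have hF1 : ∀ n z, F n z ≤ 1 := fun n z => tsub_le_self
  have hFlim : ∀ z, Tendsto (fun n => F n z) atTop (𝓝 (f z)) := by
    intro z
    have : f z = 1 - u z := (ENNReal.sub_sub_cancel ENNReal.one_ne_top (hf z)).symm
    rw [this]
    exact ENNReal.Tendsto.sub tendsto_const_nhds (hglim z) (.inl ENNReal.one_ne_top)
  have hFanti : ∀ z, Antitone fun n => F n z := fun z m n hmn => tsub_le_tsub_left (hgmono hmn z) 1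
  have hone : ∀ n z, 1 - F n z = g n z := fun n z =>
    ENNReal.sub_sub_cancel ENNReal.one_ne_top ((hgu n z).trans (hu1 z))
  have key : ∀ n, ∫⁻ ω, w (pointCount x A ω) * infProd (fun j => F n (x j ω)) ∂P =
      (∫⁻ ω, w (pointCount x A ω) ∂P) * expNeg lam (∫⁻ z, g n z) := by
    intro n
    rw [h.lintegral_mul_infProd_simpleFunc hlam hA hw (F n) (hF1 n)]
    · simp_rw [hone]
    · refine measure_ne_top_of_subset (fun z hz => ?_) (measure_spanningSets_lt_top volume n).ne
      by_contra hz'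
      exact hz (by rw [hF, hgapp, indicator_of_notMem hz', tsub_zero])
    · intro z hz
      have : g n z ≤ 0 := (hgu n z).trans (by simp [hu, hfA z hz])
      rw [hF, le_antisymm this bot_le, tsub_zero]
  have hinf : ∀ ω, Tendsto (fun n => infProd fun j => F n (x j ω)) atTop
      (𝓝 (infProd fun j => f (x j ω))) := fun ω =>
    tendsto_infProd_of_antitone (fun n j => hF1 n _) (fun j => hFanti _) fun j => hFlim _
  have hcount := h.measurable_pointCount hA
  have hL := tendsto_lintegral_of_dominated_convergence
    (F := fun n ω => w (pointCount x A ω) * infProd fun j => F n (x j ω))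
    (f := fun ω => w (pointCount x A ω) * infProd fun j => f (x j ω)) (μ := P)
    (fun ω => w (pointCount x A ω))
    (fun n => (hw.comp hcount).mul
      (measurable_infProd fun j => (F n).measurable.comp (h.measurable j)))
    (fun n => ae_of_all _ fun ω => mul_le_of_le_one_right' (infProd_le_one _)) hwA
    (by
      filter_upwards [ae_lt_top (hw.comp hcount) hwA] with ω hω
      exact ENNReal.Tendsto.const_mul (hinf ω) (.inr hω.ne))
  refine tendsto_nhds_unique hL ?_
  simp_rw [key]
  refine ENNReal.Tendsto.const_mul (tendsto_expNeg lam hfi ?_) (.inr hwA)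
  exact tendsto_lintegral_of_dominated_convergence u (fun n => (g n).measurable)
    (fun n => ae_of_all _ (hgu n)) hfi (ae_of_all _ hglim)

theorem lintegral_infProd [IsProbabilityMeasure P] (h : IsHomogeneousPPP P x lam) (hlam : 0 ≤ lam)
    {f : Plane → ℝ≥0∞} (hfm : Measurable f) (hf : ∀ z, f z ≤ 1) (hfi : ∫⁻ z, (1 - f z) ≠ ∞) :
    ∫⁻ ω, infProd (fun j => f (x j ω)) ∂P = expNeg lam (∫⁻ z, (1 - f z)) := by
  have := h.lintegral_mul_infProd hlam MeasurableSet.empty (w := fun _ => 1) measurable_const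
    (by simp) hfm hf hfi (by simp)
  simpa using this

end Coexistence.IsHomogeneousPPP

-- Campbell-Mecke and Slivnyak formulas for multiplicative functionals.

theorem tendsto_infProd_of_finite {ι : Type*} {l : Filter ι} {f : ι → ℕ → ℝ≥0∞} {g : ℕ → ℝ≥0∞}
    (hf : ∀ n j, f n j ≤ 1) (hg : ∀ j, g j ≤ 1) (s : Finset ℕ) (hfs : ∀ n, ∀ j ∉ s, f n j = 1)
    (hgs : ∀ j ∉ s, g j = 1) (h : ∀ j, Tendsto (fun n => f n j) l (𝓝 (g j))) :
    Tendsto (fun n => infProd (f n)) l (𝓝 (infProd g)) := by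
  simp_rw [fun n => infProd_eq_prod (hf n) s (hfs n), infProd_eq_prod hg s hgs]
  clear hfs hgs
  induction s using Finset.cons_induction with
  | empty => simp [tendsto_const_nhds]
  | cons a s ha ih =>
    simp_rw [Finset.prod_cons]
    have h1 : ∏ j ∈ s, g j ≠ ∞ :=
      ((Finset.prod_le_one' fun j _ => hg j).trans_lt ENNReal.one_lt_top).ne
    exact ENNReal.Tendsto.mul (h a) (.inr h1) ih (.inr ((hg a).trans_lt ENNReal.one_lt_top).ne)

namespace Coexistence.IsHomogeneousPPP

variable {Ω : Type*} [MeasurableSpace Ω] {P : Measure Ω} {x : ℕ → Ω → Plane} {lam : ℝ}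

/-- The count of `B` is an integrable majorant, and almost surely only finitely many terms of the
sum are nonzero. -/
theorem tendsto_lintegral_tsum_indicator (h : IsHomogeneousPPP P x lam) (hlam : 0 ≤ lam)
    {B : Set Plane} (hB : MeasurableSet B) (hB' : volume B ≠ ∞)
    {F : ℕ → ℕ → Ω → ℝ≥0∞} {G : ℕ → Ω → ℝ≥0∞} (hFm : ∀ n i, Measurable (F n i))
    (hF : ∀ n i ω, F n i ω ≤ 1)
    (hlim : ∀ᵐ ω ∂P, ∀ i, Tendsto (fun n => F n i ω) atTop (𝓝 (G i ω))) :
    Tendsto (fun n => ∫⁻ ω, ∑' i, B.indicator 1 (x i ω) * F n i ω ∂P) atTop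
      (𝓝 (∫⁻ ω, ∑' i, B.indicator 1 (x i ω) * G i ω ∂P)) := by
  have hBx : ∀ i, Measurable fun ω => B.indicator (1 : Plane → ℝ≥0∞) (x i ω) := fun i =>
    (measurable_one.indicator hB).comp (h.measurable i)
  refine tendsto_lintegral_of_dominated_convergence (pointCount x B)
    (fun n => Measurable.tsum fun i => (hBx i).mul (hFm n i))
    (fun n => ae_of_all _ fun ω => ENNReal.tsum_le_tsum fun i =>
      mul_le_of_le_one_right' (hF n i ω)) ?_ ?_
  · rw [h.lintegral_pointCount hlam hB hB']
    exact ENNReal.mul_ne_top ENNReal.ofReal_ne_top hB'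
  · filter_upwards [hlim, h.ae_pointCount_ne_top hB hB'] with ω hω hN
    have hfin := finite_of_pointCount_ne_top hN
    have h0 : ∀ i ∉ hfin.toFinset, B.indicator (1 : Plane → ℝ≥0∞) (x i ω) = 0 := fun i hi => by
      have : x i ω ∉ B := by simpa using hi
      simp [this]
    have h1 : ∀ a : ℕ → ℝ≥0∞, ∑' i, B.indicator 1 (x i ω) * a i =
        ∑ i ∈ hfin.toFinset, B.indicator 1 (x i ω) * a i := fun a =>
      tsum_eq_sum fun i hi => by rw [h0 i hi, zero_mul]
    simp_rw [h1]
    refine tendsto_finsetSum _ fun i _ => ENNReal.Tendsto.const_mul (hω i) (.inr ?_)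
    by_cases hi : x i ω ∈ B <;> simp [hi]

open Classical in
/-- The Campbell-Mecke formula for functionals that depend on the point only through a
simple function `r` and ignore the other points in the same cell. -/
theorem lintegral_tsum_infProd_simpleFunc (h : IsHomogeneousPPP P x lam) (hlam : 0 ≤ lam)
    {B D : Set Plane} (hB : MeasurableSet B) (hB' : volume B ≠ ∞) (hD : MeasurableSet D)
    (hD' : volume D ≠ ∞) (r : SimpleFunc Plane Plane) {G : Plane → Plane → ℝ≥0∞}
    (hGm : ∀ a, Measurable (G a)) (hG : ∀ a z, G a z ≤ 1) :
    ∫⁻ ω, ∑' i, B.indicator 1 (x i ω) *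
        infProd (fun j => if r (x j ω) = r (x i ω) ∨ x j ω ∉ D then 1
          else G (r (x i ω)) (x j ω)) ∂P =
      ENNReal.ofReal lam * ∫⁻ a in B,
        expNeg lam (∫⁻ z, (1 - if r z = r a ∨ z ∉ D then 1 else G (r a) z)) := by
  set U : Plane → Plane → ℝ≥0∞ := fun l z => if r z = l ∨ z ∉ D then 1 else G l z with hU
  have hUm : ∀ l, Measurable (U l) := fun l => Measurable.ite
    ((r.measurableSet_fiber l).union hD.compl) measurable_const (hGm l)
  have hU1 : ∀ l z, U l z ≤ 1 := fun l z => by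
    simp only [hU]; split_ifs <;> simp [hG]
  have hUi : ∀ l, ∫⁻ z, (1 - U l z) ≠ ∞ := fun l => by
    refine ne_top_of_le_ne_top hD' ?_
    rw [← lintegral_indicator_one hD]
    refine lintegral_mono fun z => ?_
    by_cases hz : z ∈ D
    · simp [hz]
    · simp [hU, hz]
  -- On the cell `A l` the factor `U l` is `1`, which makes the count of `A l` independent of the
  -- product built from `U l`.
  set A : Plane → Set Plane := fun l => B ∩ r ⁻¹' {l} with hA
  have hAm : ∀ l, MeasurableSet (A l) := fun l => hB.inter (r.measurableSet_fiber l)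
  have hA' : ∀ l, volume (A l) ≠ ∞ := fun l => measure_ne_top_of_subset inter_subset_left hB'
  have hsplit : ∀ (c : Plane → ℝ≥0∞) (a : Plane), B.indicator 1 a * c (r a) =
      ∑ l ∈ r.range, (A l).indicator 1 a * c l := by
    intro c a
    rw [Finset.sum_eq_single (r a)]
    · congr 1
      by_cases ha : a ∈ B <;> simp [hA, ha]
    · intro l _ hl
      have : a ∉ A l := fun ha => hl ha.2.symm
      simp [this]
    · exact fun hn => absurd (r.mem_range_self a) hn
  have hl : ∀ ω, ∑' i, B.indicator 1 (x i ω) * infProd (fun j => U (r (x i ω)) (x j ω)) =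
      ∑ l ∈ r.range, pointCount x (A l) ω * infProd (fun j => U l (x j ω)) := by
    intro ω
    simp_rw [fun i => hsplit (fun l => infProd fun j => U l (x j ω)) (x i ω)]
    rw [Summable.tsum_finsetSum fun _ _ => ENNReal.summable]
    simp_rw [ENNReal.tsum_mul_right]
    rfl
  have hr : ∫⁻ a in B, expNeg lam (∫⁻ z, (1 - U (r a) z)) =
      ∑ l ∈ r.range, expNeg lam (∫⁻ z, (1 - U l z)) * volume (A l) := by
    have : ∫⁻ a in B, expNeg lam (∫⁻ z, (1 - U (r a) z)) =
        (r.map fun l => expNeg lam (∫⁻ z, (1 - U l z))).lintegral (volume.restrict B) := by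
      rw [← SimpleFunc.lintegral_eq_lintegral]; rfl
    rw [this, SimpleFunc.map_lintegral]
    refine Finset.sum_congr rfl fun l _ => ?_
    rw [Measure.restrict_apply (r.measurableSet_fiber l), inter_comm]
  change ∫⁻ ω, ∑' i, B.indicator 1 (x i ω) * infProd (fun j => U (r (x i ω)) (x j ω)) ∂P =
    ENNReal.ofReal lam * ∫⁻ a in B, expNeg lam (∫⁻ z, (1 - U (r a) z))
  simp_rw [hl]
  have hm : ∀ l, Measurable fun ω => pointCount x (A l) ω * infProd fun j => U l (x j ω) :=
    fun l => (h.measurable_pointCount (hAm l)).mul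
      (measurable_infProd fun j => (hUm l).comp (h.measurable j))
  rw [hr, lintegral_finsetSum _ fun l _ => hm l, Finset.mul_sum]
  refine Finset.sum_congr rfl fun l _ => ?_
  have hN := h.lintegral_pointCount hlam (hAm l) (hA' l)
  rw [h.lintegral_mul_infProd hlam (hAm l) (w := fun a => a) measurable_id
    (hN ▸ ENNReal.mul_ne_top ENNReal.ofReal_ne_top (hA' l)) (hUm l) (hU1 l) (hUi l), hN]
  · ring
  · intro z hz
    exact if_pos (.inl hz.2)

-- Simple functions `r n` converging to the identity refine the cells. Truncation to `D` leaves
-- finitely many nontrivial factors and makes the areas finite.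
open Classical in
theorem lintegral_tsum_infProd_of_bounded (h : IsHomogeneousPPP P x lam) (hlam : 0 ≤ lam)
    {B D : Set Plane} (hB : MeasurableSet B) (hB' : volume B ≠ ∞) (hD : MeasurableSet D)
    (hD' : volume D ≠ ∞) {g : Plane → ℝ≥0∞} (hgm : Measurable g) (hg : ∀ z, g z ≤ 1)
    (hg0 : g 0 = 1) (hgc : ∀ z ≠ 0, ContinuousAt g z) :
    ∫⁻ ω, ∑' i, B.indicator 1 (x i ω) *
        infProd (fun j => if x j ω ∈ D then g (x j ω - x i ω) else 1) ∂P =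
      ENNReal.ofReal lam * ∫⁻ a in B,
        expNeg lam (∫⁻ z, (1 - if z ∈ D then g (z - a) else 1)) := by
  let r : ℕ → SimpleFunc Plane Plane := SimpleFunc.approxOn id measurable_id univ 0 (mem_univ _)
  have hr : ∀ a, Tendsto (fun n => r n a) atTop (𝓝 a) := fun a =>
    SimpleFunc.tendsto_approxOn measurable_id (mem_univ _) (by simp)
  let u : ℕ → Plane → Plane → ℝ≥0∞ := fun n a z =>
    if r n z = r n a ∨ z ∉ D then 1 else g (z - r n a)
  let v : Plane → Plane → ℝ≥0∞ := fun a z => if z ∈ D then g (z - a) else 1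
  have hu1 : ∀ n a z, u n a z ≤ 1 := fun n a z => by
    simp only [u]; split_ifs <;> simp [hg]
  have hv1 : ∀ a z, v a z ≤ 1 := fun a z => by
    simp only [v]; split_ifs <;> simp [hg]
  have huD : ∀ n a, ∀ z ∉ D, u n a z = 1 := fun n a z hz => if_pos (.inr hz)
  have hvD : ∀ a, ∀ z ∉ D, v a z = 1 := fun a z hz => if_neg hz
  have hum : ∀ n, Measurable fun p : Plane × Plane => u n p.1 p.2 := fun n => by
    refine Measurable.ite (.union ?_ (measurable_snd hD.compl)) measurable_const
      (hgm.comp (measurable_snd.sub ((r n).measurable.comp measurable_fst)))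
    exact measurableSet_eq_fun ((r n).measurable.comp measurable_snd)
      ((r n).measurable.comp measurable_fst)
  have hlim : ∀ a z, Tendsto (fun n => u n a z) atTop (𝓝 (v a z)) := by
    intro a z
    by_cases hz : z ∈ D
    · by_cases haz : z = a
      · subst haz
        -- A point at the position of the typical one, in particular that point itself, is ignored
        -- for every `n`; `g 0 = 1` makes this exact.
        have h1 : ∀ n, u n z z = v z z := fun n => by simp [u, v, hz, hg0]
        simp_rw [h1]
        exact tendsto_const_nhds
      · have hsub : Tendsto (fun n => g (z - r n a)) atTop (𝓝 (g (z - a))) :=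
          (hgc (z - a) (sub_ne_zero.2 haz)).tendsto.comp ((hr a).const_sub z)
        have h2 : v a z = g (z - a) := if_pos hz
        rw [h2]
        refine hsub.congr' ?_
        -- Distinct positions are eventually in different cells.
        have := ((hr z).prodMk_nhds (hr a)).eventually
          (isOpen_ne_fun continuous_fst continuous_snd |>.mem_nhds (x := (z, a)) haz)
        filter_upwards [this] with n hn
        exact (if_neg (by rintro (h | h); exacts [hn h, h hz])).symm
    · simp_rw [huD _ _ _ hz, hvD _ _ hz]
      exact tendsto_const_nhds
  have hbound : ∀ (f : Plane → ℝ≥0∞), (∀ z ∉ D, f z = 1) → ∀ z, 1 - f z ≤ D.indicator 1 z := by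
    intro f hf z
    by_cases hz : z ∈ D
    · simp [hz]
    · simp [hf z hz]
  have hDi : ∫⁻ z, D.indicator 1 z ≠ ∞ := by rwa [lintegral_indicator_one hD]
  have hL := h.tendsto_lintegral_tsum_indicator hlam hB hB'
    (F := fun n i ω => infProd fun j => u n (x i ω) (x j ω))
    (G := fun i ω => infProd fun j => v (x i ω) (x j ω))
    (fun n i => measurable_infProd fun j => (hum n).comp ((h.measurable i).prodMk (h.measurable j)))
    (fun n i ω => infProd_le_one _)
    (by
      filter_upwards [h.ae_pointCount_ne_top hD hD'] with ω hω i
      have hfin := finite_of_pointCount_ne_top hω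
      -- Convergence in `n` is not monotone here, but every factor of a point outside `D` is `1`.
      refine tendsto_infProd_of_finite (fun n j => hu1 n _ _) (fun j => hv1 _ _) hfin.toFinset
        (fun n j hj => huD _ _ _ (by simpa using hj)) (fun j hj => hvD _ _ (by simpa using hj))
        fun j => hlim _ _)
  refine tendsto_nhds_unique hL ?_
  simp_rw [u, fun n => h.lintegral_tsum_infProd_simpleFunc hlam hB hB' hD hD' (r n)
    (G := fun a z => g (z - a)) (fun a => hgm.comp (measurable_id.sub_const a))
    (fun a z => hg _)]
  refine ENNReal.Tendsto.const_mul ?_ (.inr ENNReal.ofReal_ne_top)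
  refine tendsto_lintegral_of_dominated_convergence
    (F := fun n a => expNeg lam (∫⁻ z, (1 - u n a z))) (fun _ => 1) (fun n => ?_)
    (fun n => ae_of_all _ fun a => expNeg_le_one hlam _) (by simpa using hB')
    (ae_of_all _ fun a => tendsto_expNeg lam ?_ ?_)
  · exact (measurable_expNeg lam).comp (measurable_const.sub (hum n)).lintegral_prod_right'
  · exact ne_top_of_le_ne_top hDi (lintegral_mono (hbound _ (hvD a)))
  · refine tendsto_lintegral_of_dominated_convergence (D.indicator 1)
      (fun n => measurable_const.sub ((hum n).comp measurable_prodMk_left))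
      (fun n => ae_of_all _ (hbound _ (huD n a))) hDi
      (ae_of_all _ fun z => ENNReal.Tendsto.sub tendsto_const_nhds (hlim a z)
        (.inl ENNReal.one_ne_top))

open Classical in
/-- The Campbell-Mecke formula combined with the Slivnyak theorem, for multiplicative
functionals of the process seen from its points. -/
theorem lintegral_tsum_infProd (h : IsHomogeneousPPP P x lam) (hlam : 0 ≤ lam)
    {B : Set Plane} (hB : MeasurableSet B) (hB' : volume B ≠ ∞)
    {g : Plane → ℝ≥0∞} (hgm : Measurable g) (hg : ∀ z, g z ≤ 1)
    (hg0 : g 0 = 1) (hgc : ∀ z ≠ 0, ContinuousAt g z) (hgi : ∫⁻ z, (1 - g z) ≠ ∞) :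
    ∫⁻ ω, ∑' i, B.indicator 1 (x i ω) * infProd (fun j => g (x j ω - x i ω)) ∂P =
      ENNReal.ofReal lam * volume B * expNeg lam (∫⁻ z, (1 - g z)) := by
  obtain ⟨D, hDm, hD', hDmono, hDex⟩ : ∃ D : ℕ → Set Plane, (∀ n, MeasurableSet (D n)) ∧
      (∀ n, volume (D n) ≠ ∞) ∧ Monotone D ∧ ∀ z, ∃ n, z ∈ D n :=
    ⟨spanningSets volume, measurableSet_spanningSets _, fun n => (measure_spanningSets_lt_top _ n).ne,
      monotone_spanningSets _, fun z => ⟨_, mem_spanningSetsIndex _ z⟩⟩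
  let v : ℕ → Plane → Plane → ℝ≥0∞ := fun n a z => if z ∈ D n then g (z - a) else 1
  have hv1 : ∀ n a z, v n a z ≤ 1 := fun n a z => by
    simp only [v]; split_ifs <;> simp [hg]
  have hgv : ∀ n a z, g (z - a) ≤ v n a z := fun n a z => by
    simp only [v]; split_ifs <;> simp [hg]
  have hvanti : ∀ a z, Antitone fun n => v n a z := fun a z m n hmn => by
    by_cases hz : z ∈ D m
    · simp [v, hz, hDmono hmn hz]
    · simpa [v, hz] using hv1 n a z
  have hvlim : ∀ a z, Tendsto (fun n => v n a z) atTop (𝓝 (g (z - a))) := fun a z => by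
    refine tendsto_const_nhds.congr' ?_
    obtain ⟨N, hN⟩ := hDex z
    filter_upwards [eventually_ge_atTop N] with n hn
    exact (if_pos (hDmono hn hN)).symm
  have hvm : ∀ n, Measurable fun p : Plane × Plane => v n p.1 p.2 := fun n =>
    Measurable.ite (measurable_snd (hDm n)) (hgm.comp (measurable_snd.sub measurable_fst))
      measurable_const
  have hL := h.tendsto_lintegral_tsum_indicator hlam hB hB'
    (F := fun n i ω => infProd fun j => v n (x i ω) (x j ω))
    (G := fun i ω => infProd fun j => g (x j ω - x i ω))
    (fun n i => measurable_infProd fun j => (hvm n).comp ((h.measurable i).prodMk (h.measurable j)))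
    (fun n i ω => infProd_le_one _)
    (ae_of_all _ fun ω i => tendsto_infProd_of_antitone (fun n j => hv1 n _ _)
      (fun j => hvanti _ _) fun j => hvlim _ _)
  refine tendsto_nhds_unique hL ?_
  simp_rw [v, fun n => h.lintegral_tsum_infProd_of_bounded hlam hB hB' (hDm n)
    (hD' n) hgm hg hg0 hgc]
  rw [mul_assoc]
  refine ENNReal.Tendsto.const_mul ?_ (.inr ENNReal.ofReal_ne_top)
  -- Stationarity: by translation invariance the exponent does not depend on the position of the
  -- typical point.
  have htr : ∀ a, ∫⁻ z, (1 - g (z - a)) = ∫⁻ z, (1 - g z) := fun a =>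
    lintegral_sub_right_eq_self (fun z => 1 - g z) a
  have hconst : volume B * expNeg lam (∫⁻ z, (1 - g z)) =
      ∫⁻ a in B, expNeg lam (∫⁻ z, (1 - g (z - a))) := by
    simp_rw [htr]
    rw [setLIntegral_const, mul_comm]
  rw [hconst]
  refine tendsto_lintegral_of_dominated_convergence
    (F := fun n a => expNeg lam (∫⁻ z, (1 - v n a z))) (fun _ => 1) (fun n => ?_)
    (fun n => ae_of_all _ fun a => expNeg_le_one hlam _) (by simpa using hB')
    (ae_of_all _ fun a => tendsto_expNeg lam ((htr a).trans_ne hgi) ?_)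
  · exact (measurable_expNeg lam).comp (measurable_const.sub (hvm n)).lintegral_prod_right'
  · exact tendsto_lintegral_of_dominated_convergence (fun z => 1 - g (z - a))
      (fun n => measurable_const.sub ((hvm n).comp measurable_prodMk_left))
      (fun n => ae_of_all _ fun z => tsub_le_tsub_left (hgv n a z) 1) ((htr a).trans_ne hgi)
      (ae_of_all _ fun z => ENNReal.Tendsto.sub tendsto_const_nhds (hvlim a z)
        (.inl ENNReal.one_ne_top))

end Coexistence.IsHomogeneousPPP

-- Adding a second, independent Poisson process.

/-- Fubini for a function of two independent random variables. -/
theorem ProbabilityTheory.IndepFun.lintegral_comp_eq_lintegral_lintegral {Ω α β : Type*}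
    [MeasurableSpace Ω] [MeasurableSpace α] [MeasurableSpace β] {P : Measure Ω} [IsFiniteMeasure P]
    {X : Ω → α} {Y : Ω → β} (h : IndepFun X Y P) (hX : Measurable X) (hY : Measurable Y)
    {F : α → β → ℝ≥0∞} (hF : Measurable (Function.uncurry F)) :
    ∫⁻ ω, F (X ω) (Y ω) ∂P = ∫⁻ ω, ∫⁻ ω', F (X ω) (Y ω') ∂P ∂P := by
  have h1 : ∫⁻ ω, F (X ω) (Y ω) ∂P = ∫⁻ p, F p.1 p.2 ∂(P.map fun ω => (X ω, Y ω)) :=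
    (lintegral_map hF (hX.prodMk hY)).symm
  rw [h1, (indepFun_iff_map_prod_eq_prod_map_map hX.aemeasurable hY.aemeasurable).1 h,
    lintegral_prod (fun p : α × β => F p.1 p.2) hF.aemeasurable,
    lintegral_map (f := fun a => ∫⁻ b, F a b ∂(P.map Y)) hF.lintegral_prod_right' hX]
  refine lintegral_congr fun ω => ?_
  exact lintegral_map (hF.comp measurable_prodMk_left) hY

theorem Coexistence.IsHomogeneousPPP.lintegral_tsum_infProd_mul_infProd {Ω : Type*}
    [MeasurableSpace Ω] {P : Measure Ω} [IsProbabilityMeasure P] {x y : ℕ → Ω → Plane}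
    {lam lam' : ℝ} (hx : IsHomogeneousPPP P x lam)
    (hy : IsHomogeneousPPP P y lam') (hxy : IndepFun (fun ω i => x i ω) (fun ω k => y k ω) P)
    (hlam : 0 ≤ lam) (hlam' : 0 ≤ lam') {B : Set Plane} (hB : MeasurableSet B)
    (hB' : volume B ≠ ∞) {g g' : Plane → ℝ≥0∞} (hgm : Measurable g) (hg : ∀ z, g z ≤ 1)
    (hg0 : g 0 = 1) (hgc : ∀ z ≠ 0, ContinuousAt g z) (hgi : ∫⁻ z, (1 - g z) ≠ ∞)
    (hgm' : Measurable g') (hg' : ∀ z, g' z ≤ 1) (hgi' : ∫⁻ z, (1 - g' z) ≠ ∞) :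
    ∫⁻ ω, ∑' i, B.indicator 1 (x i ω) * (infProd (fun j => g (x j ω - x i ω)) *
        infProd (fun m => g' (y m ω - x i ω))) ∂P =
      ENNReal.ofReal lam * volume B * (expNeg lam (∫⁻ z, (1 - g z)) *
        expNeg lam' (∫⁻ z, (1 - g' z))) := by
  let F : (ℕ → Plane) → (ℕ → Plane) → ℝ≥0∞ := fun s t => ∑' i, B.indicator 1 (s i) *
    (infProd (fun j => g (s j - s i)) * infProd (fun m => g' (t m - s i)))
  have hF : Measurable (Function.uncurry F) := by
    refine Measurable.tsum fun i => Measurable.mul ?_ (Measurable.mul ?_ ?_)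
    · exact (measurable_one.indicator hB).comp ((measurable_pi_apply i).comp measurable_fst)
    · exact measurable_infProd fun j => hgm.comp (by fun_prop)
    · exact measurable_infProd fun j => hgm'.comp (by fun_prop)
  have hmx := measurable_pi_lambda _ hx.measurable
  have hmy := measurable_pi_lambda _ hy.measurable
  have hFub := hxy.lintegral_comp_eq_lintegral_lintegral hmx hmy hF
  refine hFub.trans ?_
  -- With the first process frozen, the second contributes its Laplace functional, which is the same
  -- seen from every `x i ω`.
  have hinner : ∀ ω, ∫⁻ ω', F (fun i => x i ω) (fun k => y k ω') ∂P =
      (∑' i, B.indicator 1 (x i ω) * infProd (fun j => g (x j ω - x i ω))) *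
        expNeg lam' (∫⁻ z, (1 - g' z)) := by
    intro ω
    have hm : ∀ i, Measurable fun ω' => infProd fun m => g' (y m ω' - x i ω) := fun i =>
      measurable_infProd fun m => hgm'.comp ((hy.measurable m).sub_const _)
    rw [lintegral_tsum fun i => (((hm i).const_mul _).const_mul _).aemeasurable,
      ← ENNReal.tsum_mul_right]
    refine tsum_congr fun i => ?_
    rw [lintegral_const_mul _ ((hm i).const_mul _), lintegral_const_mul _ (hm i)]
    have htr : ∫⁻ z, (1 - g' (z - x i ω)) = ∫⁻ z, (1 - g' z) :=
      lintegral_sub_right_eq_self (fun z => 1 - g' z) _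
    rw [hy.lintegral_infProd hlam' (f := fun z => g' (z - x i ω))
      (hgm'.comp (measurable_id.sub_const _)) (fun z => hg' _) (htr.trans_ne hgi'), htr, mul_assoc]
  simp_rw [hinner]
  rw [lintegral_mul_const', hx.lintegral_tsum_infProd hlam hB hB' hgm hg hg0 hgc hgi, mul_assoc]
  exact ((expNeg_le_one hlam' _).trans_lt ENNReal.one_lt_top).ne

open Classical in
theorem infProd_ite_one_zero (p : ℕ → Prop) :
    infProd (fun j => if p j then 1 else 0) = if ∀ j, p j then 1 else 0 := by
  split_ifs with h
  · simp [h, infProd_one]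
  · push Not at h
    obtain ⟨j, hj⟩ := h
    refine le_antisymm ((iInf_le _ (j + 1)).trans ?_) bot_le
    rw [Finset.prod_eq_zero (Finset.self_mem_range_succ j) (by simp [hj])]

-- Factorization of expectations over independent timers and fading variables.

section Independence

variable {Ω ι K : Type*} [MeasurableSpace Ω] {P : Measure Ω}

-- Extension by zero puts the subfamilies into one function space, so that later compositions need
-- no subtypes.
open Classical in
theorem ProbabilityTheory.iIndepFun.indepFun_ite_ite {X : ι → Ω → ℝ} (hX : iIndepFun X P)
    (hm : ∀ i, Measurable (X i)) {S T : Finset ι} (hST : Disjoint S T) :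
    IndepFun (fun ω i => if i ∈ S then X i ω else 0) (fun ω i => if i ∈ T then X i ω else 0) P := by
  have hext : ∀ U : Finset ι, Measurable fun (f : U → ℝ) (i : ι) =>
      if h : i ∈ U then f ⟨i, h⟩ else 0 := fun U => by
    refine measurable_pi_lambda _ fun i => ?_
    by_cases h : i ∈ U
    · simpa [h] using measurable_pi_apply _
    · simp [h]
  exact (hX.indepFun_finset S T hST hm).comp (hext S) (hext T)

open Classical in
theorem ProbabilityTheory.iIndepFun.lintegral_prod_pair {T G : K → Ω → ℝ}
    (h : iIndepFun (Sum.elim T G) P) (hT : ∀ k, Measurable (T k)) (hG : ∀ k, Measurable (G k))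
    (S : Finset K) {φ : K → ℝ → ℝ → ℝ≥0∞} (hφ : ∀ k, Measurable (Function.uncurry (φ k))) :
    ∫⁻ ω, ∏ k ∈ S, φ k (T k ω) (G k ω) ∂P = ∏ k ∈ S, ∫⁻ ω, φ k (T k ω) (G k ω) ∂P := by
  have : IsProbabilityMeasure P := h.isProbabilityMeasure
  have hm : ∀ a, Measurable (Sum.elim T G a) := by rintro (k | k); exacts [hT k, hG k]
  have hφm : ∀ k, Measurable fun ω => φ k (T k ω) (G k ω) := fun k =>
    (hφ k).comp ((hT k).prodMk (hG k))
  have hpair : ∀ k, Measurable fun f : K ⊕ K → ℝ => φ k (f (.inl k)) (f (.inr k)) := fun k =>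
    (hφ k).comp (g := Function.uncurry (φ k))
      (f := fun f : K ⊕ K → ℝ => (f (.inl k), f (.inr k))) (by fun_prop)
  induction S using Finset.cons_induction with
  | empty => simp
  | cons a S ha ih =>
    simp_rw [Finset.prod_cons]
    rw [← ih]
    have hd : Disjoint (({a} : Finset K).disjSum {a}) (S.disjSum S) := by
      rw [Finset.disjoint_left]
      rintro (k | k) <;> simp +contextual [ha]
    have hi := (h.indepFun_ite_ite hm hd).comp
      (φ := fun f => φ a (f (.inl a)) (f (.inr a)))
      (ψ := fun f => ∏ k ∈ S, φ k (f (.inl k)) (f (.inr k)))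
      (hpair a) (Finset.measurable_fun_prod _ fun k _ => hpair k)
    have hi' : IndepFun (fun ω => φ a (T a ω) (G a ω)) (fun ω => ∏ k ∈ S, φ k (T k ω) (G k ω)) P := by
      convert hi using 1
      · ext ω; simp
      · ext ω
        exact Finset.prod_congr rfl fun k hk => by simp [hk]
    exact lintegral_mul_eq_lintegral_mul_lintegral_of_indepFun'' (hφm a).aemeasurable
      (Finset.measurable_fun_prod _ fun k _ => hφm k).aemeasurable hi'

-- The timer `T k₀` is shared by all factors but independent of the pairs indexed by `S`, so Fubini
-- freezes it and the pairs then factor.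
open Classical in
theorem ProbabilityTheory.iIndepFun.lintegral_prod_triple {T G : K → Ω → ℝ}
    (h : iIndepFun (Sum.elim T G) P) (hT : ∀ k, Measurable (T k)) (hG : ∀ k, Measurable (G k))
    (S : Finset K) {k₀ : K} (hk₀ : k₀ ∉ S) {φ : K → ℝ → ℝ → ℝ → ℝ≥0∞}
    (hφ : ∀ k, Measurable fun p : ℝ × ℝ × ℝ => φ k p.1 p.2.1 p.2.2) :
    ∫⁻ ω, ∏ k ∈ S, φ k (T k₀ ω) (T k ω) (G k ω) ∂P =
      ∫⁻ t, ∏ k ∈ S, ∫⁻ ω, φ k t (T k ω) (G k ω) ∂P ∂(P.map (T k₀)) := by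
  have : IsProbabilityMeasure P := h.isProbabilityMeasure
  have hm : ∀ a, Measurable (Sum.elim T G a) := by rintro (k | k); exacts [hT k, hG k]
  have hd : Disjoint ({.inl k₀} : Finset (K ⊕ K)) (S.disjSum S) := by simp [hk₀]
  let Y : Ω → K ⊕ K → ℝ := fun ω i => if i ∈ S.disjSum S then Sum.elim T G i ω else 0
  have hY : Measurable Y := measurable_pi_lambda _ fun i => by
    by_cases hi : i ∈ S.disjSum S
    · simpa [Y, hi] using hm i
    · simp [Y, hi]
  have hi : IndepFun (T k₀) Y P := by
    have := (h.indepFun_ite_ite hm hd).comp (φ := fun f : K ⊕ K → ℝ => f (.inl k₀)) (ψ := id)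
      (measurable_pi_apply (X := fun _ : K ⊕ K => ℝ) _) measurable_id
    convert this using 1
    · ext ω; simp
    · ext ω i; simp [Y]
  have hYT : ∀ t ω, ∏ k ∈ S, φ k t (Y ω (.inl k)) (Y ω (.inr k)) =
      ∏ k ∈ S, φ k t (T k ω) (G k ω) := fun t ω =>
    Finset.prod_congr rfl fun k hk => by simp [Y, hk]
  have hFub := hi.lintegral_comp_eq_lintegral_lintegral (hT k₀) hY
    (F := fun t f => ∏ k ∈ S, φ k t (f (.inl k)) (f (.inr k)))
    (Finset.measurable_fun_prod _ fun k _ => (hφ k).comp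
      (f := fun p : ℝ × (K ⊕ K → ℝ) => (p.1, p.2 (.inl k), p.2 (.inr k))) (by fun_prop))
  simp_rw [hYT] at hFub
  have hm2 : ∀ k, Measurable fun t => ∫⁻ ω, φ k t (T k ω) (G k ω) ∂P := fun k => by
    have h1 : Measurable (Function.uncurry fun t ω => φ k t (T k ω) (G k ω)) :=
      (hφ k).comp (measurable_fst.prodMk
        (((hT k).comp measurable_snd).prodMk ((hG k).comp measurable_snd)))
    exact h1.lintegral_prod_right'
  rw [hFub, lintegral_map (Finset.measurable_fun_prod _ fun k _ => hm2 k) (hT k₀)]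
  refine lintegral_congr fun ω => ?_
  exact h.lintegral_prod_pair hT hG S (φ := fun k => φ k (T k₀ ω)) fun k =>
    (hφ k).comp measurable_prodMk_left

end Independence

-- Blocking probabilities for fixed positions.

section Blocking

variable {Ω : Type*} [MeasurableSpace Ω] {P : Measure Ω}

theorem measurableSet_setOf_notBlocked {α : Type*} [MeasurableSpace α] {t' t G pl : α → ℝ}
    (h1 : Measurable t') (h2 : Measurable t) (h3 : Measurable G) (h4 : Measurable pl) (Γ pow : ℝ) :
    MeasurableSet {a | NotBlocked (t' a) (t a) (G a) (pl a) Γ pow} :=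
  (measurableSet_le h2 h1).union ((measurableSet_lt h1 h2).inter
    (measurableSet_le (h3.div h4) measurable_const))

theorem map_eq_restrict_of_isUniform {T : Ω → ℝ} (hT : pdf.IsUniform T (Icc 0 1) P) :
    P.map T = volume.restrict (Icc 0 1) := by
  rw [hT, ProbabilityTheory.cond]
  simp

theorem measure_lt_of_isUniform {T : Ω → ℝ} (hTm : Measurable T)
    (hT : pdf.IsUniform T (Icc 0 1) P) {t : ℝ} (ht : t ∈ Icc (0 : ℝ) 1) :
    P {ω | T ω < t} = ENNReal.ofReal t := by
  have : P {ω | T ω < t} = P.map T (Iio t) := (Measure.map_apply hTm measurableSet_Iio).symm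
  rw [this, map_eq_restrict_of_isUniform hT, Measure.restrict_apply measurableSet_Iio]
  have : Iio t ∩ Icc (0 : ℝ) 1 = Ico 0 t := by
    ext s
    simp only [mem_inter_iff, mem_Iio, mem_Icc, mem_Ico]
    exact ⟨fun h => ⟨h.2.1, h.1⟩, fun h => ⟨h.2, h.1, h.2.le.trans ht.2⟩⟩
  rw [this, Real.volume_Ico, sub_zero]

theorem measure_lt_of_hasLaw_expMeasure [IsProbabilityMeasure P] {G : Ω → ℝ} (hGm : Measurable G)
    {μ : ℝ} (hμ : 0 < μ) (hG : HasLaw G (expMeasure μ) P) {c : ℝ} (hc : 0 ≤ c) :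
    P {ω | c < G ω} = ENNReal.ofReal (Real.exp (-(μ * c))) := by
  have := isProbabilityMeasure_expMeasure hμ
  have h1 : P {ω | c < G ω} = expMeasure μ (Iic c)ᶜ := by
    rw [← hG.map_eq, Measure.map_apply hGm measurableSet_Iic.compl]
    simp [preimage]
  rw [h1, prob_compl_eq_one_sub measurableSet_Iic, ← ofReal_cdf, cdf_expMeasure_eq hμ, if_pos hc,
    ← ENNReal.ofReal_one, ← ENNReal.ofReal_sub _ (by simp; positivity)]
  simp

theorem measure_notBlocked [IsProbabilityMeasure P] {T G : Ω → ℝ} (hTm : Measurable T)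
    (hGm : Measurable G) (hTG : IndepFun T G P) (hT : pdf.IsUniform T (Icc 0 1) P) {μ : ℝ}
    (hμ : 0 < μ) (hG : HasLaw G (expMeasure μ) P) {t : ℝ} (ht : t ∈ Icc (0 : ℝ) 1) {pl Γ pow : ℝ}
    (hpl : 0 ≤ pl) (hΓ : 0 < Γ) (hpow : 0 < pow) :
    P {ω | NotBlocked (T ω) t (G ω) pl Γ pow} = 1 - ENNReal.ofReal t *
      if pl = 0 then 0 else ENNReal.ofReal (Real.exp (-(μ * (Γ / pow) * pl))) := by
  have hm := measurableSet_setOf_notBlocked hTm (measurable_const (a := t)) hGm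
    (measurable_const (a := pl)) Γ pow
  have hΓp : 0 < Γ / pow := by positivity
  rw [← compl_compl {ω | NotBlocked (T ω) t (G ω) pl Γ pow}, prob_compl_eq_one_sub hm.compl]
  congr 1
  have hcompl : {ω | NotBlocked (T ω) t (G ω) pl Γ pow}ᶜ =
      {ω | T ω < t} ∩ {ω | Γ / pow < G ω / pl} := by
    ext ω
    simp only [NotBlocked, mem_compl_iff, mem_ofPred_eq, mem_inter_iff, ge_iff_le, not_or, not_le,
      not_and]
    exact ⟨fun h => ⟨h.1, h.2 h.1⟩, fun h => ⟨h.1, fun _ => h.2⟩⟩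
  rw [hcompl]
  split_ifs with h0
  -- Here `G / 0 = 0` is below the positive threshold, so a transmitter at distance zero never
  -- blocks.
  · simp [h0, hΓp.not_gt]
  · have hpl' : 0 < pl := lt_of_le_of_ne hpl (Ne.symm h0)
    simp_rw [lt_div_iff₀ hpl']
    rw [mul_assoc, ← measure_lt_of_isUniform hTm hT ht,
      ← measure_lt_of_hasLaw_expMeasure hGm hμ hG (by positivity : 0 ≤ Γ / pow * pl)]
    exact hTG.measure_inter_preimage_eq_mul (Iio t) (Ioi (Γ / pow * pl)) measurableSet_Iio
      measurableSet_Ioi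

/-- The probability that a node is not blocked by any of the other nodes at given distances,
as an integral over its own timer. -/
theorem measure_forall_notBlocked [IsProbabilityMeasure P] {T G : ℕ ⊕ ℕ → Ω → ℝ}
    (h : iIndepFun (Sum.elim T G) P) (hTm : ∀ k, Measurable (T k)) (hGm : ∀ k, Measurable (G k))
    (hT : ∀ k, pdf.IsUniform (T k) (Icc 0 1) P) {μ : ℝ} (hμ : 0 < μ)
    (hG : ∀ k, HasLaw (G k) (expMeasure μ) P) {k₀ : ℕ ⊕ ℕ} {pl Γ pow : ℕ ⊕ ℕ → ℝ}
    (hpl : ∀ k, 0 ≤ pl k) (hpl0 : pl k₀ = 0) (hΓ : ∀ k, 0 < Γ k) (hpow : ∀ k, 0 < pow k)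
    {b : ℕ ⊕ ℕ → ℝ≥0∞} (hb : ∀ k, b k =
      if pl k = 0 then 0 else ENNReal.ofReal (Real.exp (-(μ * (Γ k / pow k) * pl k)))) :
    P {ω | ∀ k, NotBlocked (T k ω) (T k₀ ω) (G k ω) (pl k) (Γ k) (pow k)} =
      ∫⁻ t in Icc (0 : ℝ) 1, infProd (fun j => 1 - ENNReal.ofReal t * b (.inl j)) *
        infProd (fun m => 1 - ENNReal.ofReal t * b (.inr m)) := by
  classical
  let φ : ℕ ⊕ ℕ → ℝ → ℝ → ℝ → ℝ≥0∞ := fun k t t' g =>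
    if NotBlocked t' t g (pl k) (Γ k) (pow k) then 1 else 0
  have hφ1 : ∀ k t t' g, φ k t t' g ≤ 1 := fun k t t' g => by
    simp only [φ]; split_ifs <;> simp
  have hφm : ∀ k, Measurable fun p : ℝ × ℝ × ℝ => φ k p.1 p.2.1 p.2.2 := fun k =>
    Measurable.ite (measurableSet_setOf_notBlocked (by fun_prop) (by fun_prop) (by fun_prop)
      measurable_const _ _) measurable_const measurable_const
  have hφ0 : ∀ ω, φ k₀ (T k₀ ω) (T k₀ ω) (G k₀ ω) = 1 := fun ω => if_pos (.inl le_rfl)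
  have hb0 : b k₀ = 0 := by simp [hb, hpl0]
  let S : ℕ → Finset (ℕ ⊕ ℕ) := fun n => (Finset.range n).disjSum (Finset.range n)
  have hlim : ∀ f : ℕ ⊕ ℕ → ℝ≥0∞, (∀ k, f k ≤ 1) → Tendsto (fun n => ∏ k ∈ S n, f k) atTop
      (𝓝 (infProd (fun j => f (.inl j)) * infProd fun m => f (.inr m))) := fun f hf => by
    simp_rw [S, Finset.prod_disjSum]
    exact ENNReal.Tendsto.mul (tendsto_infProd fun j => hf _)
      (.inr ((infProd_le_one _).trans_lt ENNReal.one_lt_top).ne) (tendsto_infProd fun j => hf _)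
      (.inr ((infProd_le_one _).trans_lt ENNReal.one_lt_top).ne)
  have hE : MeasurableSet {ω | ∀ k, NotBlocked (T k ω) (T k₀ ω) (G k ω) (pl k) (Γ k) (pow k)} := by
    rw [ofPred_forall]
    exact MeasurableSet.iInter fun k => measurableSet_setOf_notBlocked (hTm k) (hTm k₀) (hGm k)
      measurable_const _ _
  have hfin : ∀ n, ∫⁻ ω, ∏ k ∈ S n, φ k (T k₀ ω) (T k ω) (G k ω) ∂P =
      ∫⁻ t in Icc (0 : ℝ) 1, ∏ k ∈ S n, (1 - ENNReal.ofReal t * b k) := by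
    intro n
    -- The node does not block itself. Removing `k₀` leaves only timers independent of `T k₀`;
    -- putting it back on the other side is free because `b k₀ = 0`.
    have hl : ∀ ω, ∏ k ∈ S n, φ k (T k₀ ω) (T k ω) (G k ω) =
        ∏ k ∈ (S n).erase k₀, φ k (T k₀ ω) (T k ω) (G k ω) := fun ω =>
      (Finset.prod_erase (S n) (f := fun k => φ k (T k₀ ω) (T k ω) (G k ω)) (hφ0 ω)).symm
    simp_rw [hl]
    rw [h.lintegral_prod_triple hTm hGm _ (Finset.notMem_erase k₀ _) hφm,
      map_eq_restrict_of_isUniform (hT k₀)]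
    refine setLIntegral_congr_fun measurableSet_Icc fun t ht => ?_
    rw [← Finset.prod_erase (S n) (f := fun k => 1 - ENNReal.ofReal t * b k) (a := k₀)
      (by simp [hb0])]
    refine Finset.prod_congr rfl fun k _ => ?_
    have hTG : IndepFun (T k) (G k) P := h.indepFun (i := .inl k) (j := .inr k) (by simp)
    rw [hb, ← measure_notBlocked (hTm k) (hGm k) hTG (hT k) hμ (hG k) ht (hpl k) (hΓ k) (hpow k),
      ← lintegral_indicator_one (measurableSet_setOf_notBlocked (hTm k) measurable_const (hGm k)
      measurable_const _ _)]
    rfl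
  have hind : ∀ ω, infProd (fun j => φ (.inl j) (T k₀ ω) (T (.inl j) ω) (G (.inl j) ω)) *
      infProd (fun m => φ (.inr m) (T k₀ ω) (T (.inr m) ω) (G (.inr m) ω)) =
      {ω | ∀ k, NotBlocked (T k ω) (T k₀ ω) (G k ω) (pl k) (Γ k) (pow k)}.indicator 1 ω := by
    intro ω
    simp only [φ]
    rw [infProd_ite_one_zero, infProd_ite_one_zero, indicator_apply]
    simp only [mem_ofPred_eq, Sum.forall]
    split_ifs <;> simp_all
  rw [← lintegral_indicator_one hE]
  simp_rw [← hind]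
  have hL := tendsto_lintegral_of_dominated_convergence (μ := P)
    (F := fun n ω => ∏ k ∈ S n, φ k (T k₀ ω) (T k ω) (G k ω)) (fun _ => 1)
    (fun n => Finset.measurable_fun_prod _ fun k _ =>
      (hφm k).comp ((hTm k₀).prodMk ((hTm k).prodMk (hGm k))))
    (fun n => ae_of_all _ fun ω => Finset.prod_le_one' fun k _ => hφ1 _ _ _ _) (by simp)
    (ae_of_all _ fun ω => hlim (fun k => φ k (T k₀ ω) (T k ω) (G k ω)) fun k => hφ1 _ _ _ _)
  refine tendsto_nhds_unique hL ?_
  simp_rw [hfin]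
  exact tendsto_lintegral_of_dominated_convergence (fun _ => 1)
    (fun n => Finset.measurable_fun_prod _ fun k _ => by fun_prop)
    (fun n => ae_of_all _ fun t => Finset.prod_le_one' fun k _ => tsub_le_self) (by simp)
    (ae_of_all _ fun t => hlim (fun k => 1 - ENNReal.ofReal t * b k) fun k => tsub_le_self)

end Blocking

-- Path loss and detection probability.

namespace Coexistence.Params

variable (q : Params)

theorem pathLoss_zero : q.pathLoss 0 = 0 := by
  simp [pathLoss, Real.zero_rpow q.α_pos.ne']

theorem pathLoss_pos {d : ℝ} (hd : 0 < d) : 0 < q.pathLoss d := by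
  have := q.lamC_pos
  have := Real.pi_pos
  unfold pathLoss
  positivity

theorem pathLoss_nonneg {d : ℝ} (hd : 0 ≤ d) : 0 ≤ q.pathLoss d := by
  have := q.lamC_pos
  unfold pathLoss
  positivity

theorem continuous_pathLoss : Continuous q.pathLoss :=
  continuous_const.mul (Real.continuous_rpow_const q.α_pos.le)

/-- The probability that a transmitter at displacement `z` is detected, as a function of the
scaled threshold `c`. A transmitter at the same position does not count. -/
noncomputable def detectProb (c : ℝ) (z : Plane) : ℝ≥0∞ :=
  if q.pathLoss ‖z‖ = 0 then 0 else ENNReal.ofReal (Real.exp (-(c * q.pathLoss ‖z‖)))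

theorem detectProb_zero (c : ℝ) : q.detectProb c 0 = 0 := by
  simp [detectProb, q.pathLoss_zero]

theorem detectProb_of_ne_zero (c : ℝ) {z : Plane} (hz : z ≠ 0) :
    q.detectProb c z = ENNReal.ofReal (Real.exp (-(c * q.pathLoss ‖z‖))) :=
  if_neg (q.pathLoss_pos (norm_pos_iff.2 hz)).ne'

theorem continuous_exp_pathLoss (c : ℝ) :
    Continuous fun z : Plane => Real.exp (-(c * q.pathLoss ‖z‖)) :=
  Real.continuous_exp.comp (continuous_const.mul (q.continuous_pathLoss.comp continuous_norm)).neg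

theorem measurable_detectProb (c : ℝ) : Measurable (q.detectProb c) :=
  Measurable.ite ((q.continuous_pathLoss.comp continuous_norm).measurable (measurableSet_singleton 0))
    measurable_const (q.continuous_exp_pathLoss c).measurable.ennreal_ofReal

theorem detectProb_le_one {c : ℝ} (hc : 0 ≤ c) (z : Plane) : q.detectProb c z ≤ 1 := by
  unfold detectProb
  split_ifs
  · simp
  · rw [ENNReal.ofReal_le_one, Real.exp_le_one_iff, neg_nonpos]
    exact mul_nonneg hc (q.pathLoss_nonneg (norm_nonneg z))

theorem continuousAt_detectProb (c : ℝ) {z : Plane} (hz : z ≠ 0) :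
    ContinuousAt (q.detectProb c) z := by
  have h : ContinuousAt (fun z : Plane => ENNReal.ofReal (Real.exp (-(c * q.pathLoss ‖z‖)))) z :=
    (ENNReal.continuous_ofReal.comp (q.continuous_exp_pathLoss c)).continuousAt
  refine h.congr ?_
  filter_upwards [isOpen_ne.mem_nhds hz] with w hw
  exact (q.detectProb_of_ne_zero c hw).symm

theorem integrable_exp_pathLoss {c : ℝ} (hc : 0 < c) :
    Integrable fun z : Plane => Real.exp (-(c * q.pathLoss ‖z‖)) := by
  -- Polar coordinates in dimension two give the weight `r ^ 1`, whence `s = 1` below.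
  refine (integrable_fun_norm_addHaar volume (f := fun r => Real.exp (-(c * q.pathLoss r)))).2 ?_
  have hb : 0 < c * (4 * Real.pi / q.lamC) ^ 2 := by
    have := q.lamC_pos
    have := Real.pi_pos
    positivity
  have := integrableOn_rpow_mul_exp_neg_mul_rpow (s := 1) (by norm_num) q.α_pos hb
  simpa [pathLoss, mul_assoc] using this

theorem integral_exp_pathLoss_pos {c : ℝ} (hc : 0 < c) :
    0 < ∫ z : Plane, Real.exp (-(c * q.pathLoss ‖z‖)) :=
  integral_exp_pos (q.integrable_exp_pathLoss hc)

theorem lintegral_detectProb {c : ℝ} (hc : 0 < c) :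
    ∫⁻ z, q.detectProb c z = ENNReal.ofReal (∫ z : Plane, Real.exp (-(c * q.pathLoss ‖z‖))) := by
  rw [ofReal_integral_eq_lintegral_ofReal (q.integrable_exp_pathLoss hc)
    (ae_of_all _ fun z => (Real.exp_pos _).le)]
  refine lintegral_congr_ae ?_
  filter_upwards [compl_mem_ae_iff.2 (measure_singleton (0 : Plane))] with z hz
  exact q.detectProb_of_ne_zero c hz

/-- The complement of the closed ball of radius `0` omits only the origin, a null set. -/
theorem NW3_eq (Γ : ℝ) :
    q.NW3 Γ = q.lamW * ∫ z : Plane, Real.exp (-(q.μ * (Γ / q.PW) * q.pathLoss ‖z‖)) := by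
  simp [NW3, NW0]

theorem NL3_eq (Γ : ℝ) :
    q.NL3 Γ = q.lamL * ∫ z : Plane, Real.exp (-(q.μ * (Γ / q.PL) * q.pathLoss ‖z‖)) := by
  simp [NL3, NL0]

end Coexistence.Params

theorem lintegral_Icc_exp_neg_mul {N : ℝ} (hN : 0 < N) :
    ∫⁻ t in Icc (0 : ℝ) 1, ENNReal.ofReal (Real.exp (-(t * N))) =
      ENNReal.ofReal ((1 - Real.exp (-N)) / N) := by
  have hc : Continuous fun t : ℝ => Real.exp (-(t * N)) := by fun_prop
  rw [← ofReal_integral_eq_lintegral_ofReal (hc.integrableOn_Icc)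
    (ae_of_all _ fun t => (Real.exp_pos _).le), integral_Icc_eq_integral_Ioc,
    ← intervalIntegral.integral_of_le zero_le_one]
  congr 1
  have hd : ∀ t ∈ uIcc (0 : ℝ) 1, HasDerivAt (fun t => -Real.exp (-(t * N)) / N)
      (Real.exp (-(t * N))) t := fun t _ => by
    have h1 : HasDerivAt (fun t : ℝ => -(t * N)) (-(1 * N)) t := ((hasDerivAt_id t).mul_const N).neg
    refine (h1.exp.neg.div_const N).congr_deriv ?_
    field_simp
  rw [intervalIntegral.integral_eq_sub_of_hasDerivAt hd (hc.intervalIntegrable _ _)]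
  simp
  ring

-- From access events to the Palm probability.

section Access

variable {Ω ι : Type*} [MeasurableSpace Ω] {P : Measure Ω} [IsProbabilityMeasure P]

/-- The probability that point `i` is in `B` and has access, as an integral over its timer of an
expectation of a multiplicative functional of the point processes. -/
theorem measure_access (q : Params) {x y : ℕ → Ω → Plane} (hx : ∀ i, Measurable (x i))
    (hy : ∀ k, Measurable (y k)) {M : ι → Ω → ℝ} (hM : ∀ m, Measurable (M m)) (hMi : iIndepFun M P)
    (hind : IndepFun (fun ω => ((fun i => x i ω), (fun k => y k ω))) (fun ω m => M m ω) P)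
    {t g : ℕ ⊕ ℕ → ι} (hinj : Function.Injective (Sum.elim t g))
    (hT : ∀ k, pdf.IsUniform (M (t k)) (Icc 0 1) P)
    (hG : ∀ k, HasLaw (M (g k)) (expMeasure q.μ) P)
    {Γ₁ p₁ Γ₂ p₂ : ℝ} (hΓ₁ : 0 < Γ₁) (hp₁ : 0 < p₁) (hΓ₂ : 0 < Γ₂) (hp₂ : 0 < p₂)
    {B : Set Plane} (hB : MeasurableSet B) (i : ℕ) {E : Set Ω}
    (hE : E = {ω | (∀ j, j ≠ i → NotBlocked (M (t (.inl j)) ω) (M (t (.inl i)) ω)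
        (M (g (.inl j)) ω) (q.pathLoss ‖x j ω - x i ω‖) Γ₁ p₁) ∧
      ∀ m, NotBlocked (M (t (.inr m)) ω) (M (t (.inl i)) ω)
        (M (g (.inr m)) ω) (q.pathLoss ‖y m ω - x i ω‖) Γ₂ p₂}) :
    MeasurableSet E ∧ P (x i ⁻¹' B ∩ E) = ∫⁻ s in Icc (0 : ℝ) 1, ∫⁻ ω, B.indicator 1 (x i ω) *
      (infProd (fun j => 1 - ENNReal.ofReal s * q.detectProb (q.μ * (Γ₁ / p₁)) (x j ω - x i ω)) *
      infProd (fun m => 1 - ENNReal.ofReal s * q.detectProb (q.μ * (Γ₂ / p₂)) (y m ω - x i ω))) ∂P := by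
  classical
  let pl : (ℕ → Plane) × (ℕ → Plane) → ℕ ⊕ ℕ → ℝ := fun p => Sum.elim
    (fun j => q.pathLoss ‖p.1 j - p.1 i‖) (fun m => q.pathLoss ‖p.2 m - p.1 i‖)
  let Γ : ℕ ⊕ ℕ → ℝ := Sum.elim (fun _ => Γ₁) fun _ => Γ₂
  let pow : ℕ ⊕ ℕ → ℝ := Sum.elim (fun _ => p₁) fun _ => p₂
  let C : (ℕ → Plane) × (ℕ → Plane) → (ι → ℝ) → Prop := fun p f =>
    ∀ k, NotBlocked (f (t k)) (f (t (.inl i))) (f (g k)) (pl p k) (Γ k) (pow k)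
  let pts : Ω → (ℕ → Plane) × (ℕ → Plane) := fun ω => ((fun i => x i ω), (fun k => y k ω))
  let marks : Ω → ι → ℝ := fun ω m => M m ω
  -- The restriction `j ≠ i` can be dropped, since equal timers never block; this gives a condition
  -- uniform over `ℕ ⊕ ℕ`.
  have hEC : E = {ω | C (pts ω) (marks ω)} := by
    rw [hE]
    ext ω
    refine ⟨fun h k => ?_, fun h => ⟨fun j _ => h (.inl j), fun m => h (.inr m)⟩⟩
    rcases k with j | m
    · by_cases hj : j = i
      · exact hj ▸ Or.inl le_rfl
      · exact h.1 j hj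
    · exact h.2 m
  have hplm : ∀ k, Measurable fun p => pl p k := by
    have := q.continuous_pathLoss.measurable
    rintro (k | k)
    · exact this.comp (f := fun p : (ℕ → Plane) × (ℕ → Plane) => ‖p.1 k - p.1 i‖) (by fun_prop)
    · exact this.comp (f := fun p : (ℕ → Plane) × (ℕ → Plane) => ‖p.2 k - p.1 i‖) (by fun_prop)
  have hCm : MeasurableSet {a : ((ℕ → Plane) × (ℕ → Plane)) × (ι → ℝ) | C a.1 a.2} := by
    have : {a : ((ℕ → Plane) × (ℕ → Plane)) × (ι → ℝ) | C a.1 a.2} =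
        ⋂ k, {a | NotBlocked (a.2 (t k)) (a.2 (t (.inl i))) (a.2 (g k)) (pl a.1 k)
          (Γ k) (pow k)} := by
      ext a; simp [C]
    rw [this]
    exact MeasurableSet.iInter fun k => measurableSet_setOf_notBlocked (by fun_prop) (by fun_prop)
      (by fun_prop) ((hplm k).comp measurable_fst) _ _
  have hptsm : Measurable pts := (measurable_pi_lambda _ hx).prodMk (measurable_pi_lambda _ hy)
  have hmarksm : Measurable marks := measurable_pi_lambda _ hM
  have hEm : MeasurableSet E := hEC ▸ (hptsm.prodMk hmarksm) hCm
  refine ⟨hEm, ?_⟩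
  have hfix : ∀ p : (ℕ → Plane) × (ℕ → Plane), P {ω | C p (marks ω)} = ∫⁻ s in Icc (0 : ℝ) 1,
      infProd (fun j => 1 - ENNReal.ofReal s * q.detectProb (q.μ * (Γ₁ / p₁)) (p.1 j - p.1 i)) *
      infProd (fun m => 1 - ENNReal.ofReal s * q.detectProb (q.μ * (Γ₂ / p₂)) (p.2 m - p.1 i)) := by
    intro p
    refine measure_forall_notBlocked (T := fun k => M (t k)) (G := fun k => M (g k)) (k₀ := .inl i)
      (pl := pl p) (Γ := Γ) (pow := pow)
      (b := Sum.elim (fun j => q.detectProb (q.μ * (Γ₁ / p₁)) (p.1 j - p.1 i))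
        fun m => q.detectProb (q.μ * (Γ₂ / p₂)) (p.2 m - p.1 i))
      ?_ (fun k => hM _) (fun k => hM _) hT q.μ_pos hG ?_ ?_ ?_ ?_ ?_
    -- Injectivity of the labelling makes the timers and the fading variables towards point `i` an
    -- independent subfamily of the marks.
    · have := hMi.precomp hinj
      convert this using 1
      ext (k | k) <;> rfl
    · rintro (k | k) <;> exact q.pathLoss_nonneg (norm_nonneg _)
    · simp [pl, q.pathLoss_zero]
    · rintro (k | k) <;> assumption
    · rintro (k | k) <;> assumption
    · rintro (k | k) <;> rfl
  let F : (ℕ → Plane) × (ℕ → Plane) → (ι → ℝ) → ℝ≥0∞ := fun p f =>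
    B.indicator 1 (p.1 i) * if C p f then 1 else 0
  have hBm : Measurable fun p : (ℕ → Plane) × (ℕ → Plane) => B.indicator (1 : Plane → ℝ≥0∞) (p.1 i) :=
    (measurable_one.indicator hB).comp ((measurable_pi_apply i).comp measurable_fst)
  have hFm : Measurable (Function.uncurry F) := (hBm.comp measurable_fst).mul
    (Measurable.ite hCm measurable_const measurable_const)
  have h1 : P (x i ⁻¹' B ∩ E) = ∫⁻ ω, F (pts ω) (marks ω) ∂P := by
    rw [← lintegral_indicator_one ((hx i hB).inter hEm)]
    refine lintegral_congr fun ω => ?_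
    have hω : ω ∈ E ↔ C (pts ω) (marks ω) := by rw [hEC]; rfl
    by_cases ha : x i ω ∈ B <;> by_cases hb : ω ∈ E
    · have := hω.1 hb
      simp [F, ha, hb, this, pts]
    · have : ¬ C (pts ω) (marks ω) := fun h => hb (hω.2 h)
      simp [F, hb, this]
    · simp [F, ha, pts]
    · simp [F, ha, pts]
  have h2 : ∀ ω, ∫⁻ ω', F (pts ω) (marks ω') ∂P =
      ∫⁻ s in Icc (0 : ℝ) 1, B.indicator 1 (x i ω) *
      (infProd (fun j => 1 - ENNReal.ofReal s * q.detectProb (q.μ * (Γ₁ / p₁)) (x j ω - x i ω)) *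
      infProd (fun m => 1 - ENNReal.ofReal s * q.detectProb (q.μ * (Γ₂ / p₂)) (y m ω - x i ω))) := by
    intro ω
    have hm : MeasurableSet {ω' | C (pts ω) (marks ω')} :=
      hmarksm (measurable_prodMk_left (x := pts ω) hCm)
    have hne : B.indicator (1 : Plane → ℝ≥0∞) (x i ω) ≠ ∞ := by
      by_cases ha : x i ω ∈ B <;> simp [ha]
    refine (lintegral_const_mul' _ (fun ω' => if C (pts ω) (marks ω') then 1 else 0) hne).trans
      (Eq.trans ?_ (lintegral_const_mul' _ _ hne).symm)
    congr 1
    refine Eq.trans ?_ (hfix (pts ω))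
    rw [← lintegral_indicator_one hm]
    rfl
  have hdm := q.measurable_detectProb
  rw [h1, hind.lintegral_comp_eq_lintegral_lintegral hptsm hmarksm hFm]
  refine (lintegral_congr h2).trans ?_
  refine lintegral_lintegral_swap (Measurable.aemeasurable ?_)
  refine Measurable.mul (((measurable_one.indicator hB).comp (hx i)).comp measurable_fst) (.mul ?_ ?_)
  · exact measurable_infProd fun j => measurable_const.sub
      ((ENNReal.measurable_ofReal.comp measurable_snd).mul
        ((hdm _).comp (((hx j).sub (hx i)).comp measurable_fst)))
  · exact measurable_infProd fun j => measurable_const.sub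
      ((ENNReal.measurable_ofReal.comp measurable_snd).mul
        ((hdm _).comp (((hy j).sub (hx i)).comp measurable_fst)))

theorem palmProb_access (q : Params) {x y : ℕ → Ω → Plane} {lam lam' : ℝ}
    (hlam : 0 < lam) (hlam' : 0 < lam')
    (hx : IsHomogeneousPPP P x lam) (hy : IsHomogeneousPPP P y lam')
    (hxy : IndepFun (fun ω i => x i ω) (fun ω k => y k ω) P)
    {M : ι → Ω → ℝ} (hM : ∀ m, Measurable (M m)) (hMi : iIndepFun M P)
    (hind : IndepFun (fun ω => ((fun i => x i ω), (fun k => y k ω))) (fun ω m => M m ω) P)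
    {t : ℕ ⊕ ℕ → ι} {g : ℕ → ℕ ⊕ ℕ → ι} (hinj : ∀ i, Function.Injective (Sum.elim t (g i)))
    (hT : ∀ k, pdf.IsUniform (M (t k)) (Icc 0 1) P)
    (hG : ∀ i k, HasLaw (M (g i k)) (expMeasure q.μ) P)
    {Γ₁ p₁ Γ₂ p₂ : ℝ} (hΓ₁ : 0 < Γ₁) (hp₁ : 0 < p₁) (hΓ₂ : 0 < Γ₂) (hp₂ : 0 < p₂)
    {B : Set Plane} (hB : MeasurableSet B) (hB0 : volume B ≠ 0) (hB1 : volume B ≠ ∞)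
    {E : ℕ → Set Ω}
    (hE : ∀ i, E i = {ω | (∀ j, j ≠ i → NotBlocked (M (t (.inl j)) ω) (M (t (.inl i)) ω)
        (M (g i (.inl j)) ω) (q.pathLoss ‖x j ω - x i ω‖) Γ₁ p₁) ∧
      ∀ m, NotBlocked (M (t (.inr m)) ω) (M (t (.inl i)) ω)
        (M (g i (.inr m)) ω) (q.pathLoss ‖y m ω - x i ω‖) Γ₂ p₂})
    {N₁ N₂ : ℝ}
    (hN₁ : N₁ = lam * ∫ z : Plane, Real.exp (-(q.μ * (Γ₁ / p₁) * q.pathLoss ‖z‖)))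
    (hN₂ : N₂ = lam' * ∫ z : Plane, Real.exp (-(q.μ * (Γ₂ / p₂) * q.pathLoss ‖z‖))) :
    palmProb P x lam E B = ENNReal.ofReal ((1 - Real.exp (-N₁ - N₂)) / (N₁ + N₂)) := by
  have hμ := q.μ_pos
  set c₁ := q.μ * (Γ₁ / p₁) with hc₁
  set c₂ := q.μ * (Γ₂ / p₂) with hc₂
  have hc₁0 : 0 < c₁ := by positivity
  have hc₂0 : 0 < c₂ := by positivity
  have hI₁ := q.integral_exp_pathLoss_pos hc₁0
  have hI₂ := q.integral_exp_pathLoss_pos hc₂0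
  have hdm := q.measurable_detectProb
  have hacc := fun i => measure_access q hx.measurable hy.measurable hM hMi hind (hinj i) hT (hG i)
    hΓ₁ hp₁ hΓ₂ hp₂ hB i (hE i)
  have hsub : ∀ {c : ℝ} (_ : 0 < c) {s : ℝ} (_ : s ∈ Icc (0 : ℝ) 1),
      ∫⁻ z, (1 - (1 - ENNReal.ofReal s * q.detectProb c z)) =
        ENNReal.ofReal (s * ∫ z : Plane, Real.exp (-(c * q.pathLoss ‖z‖))) := by
    intro c hc s hs
    have : ∀ z, 1 - (1 - ENNReal.ofReal s * q.detectProb c z) =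
        ENNReal.ofReal s * q.detectProb c z := fun z =>
      ENNReal.sub_sub_cancel ENNReal.one_ne_top
        (mul_le_one' (ENNReal.ofReal_le_one.2 hs.2) (q.detectProb_le_one hc.le z))
    simp_rw [this]
    rw [lintegral_const_mul _ (hdm c), q.lintegral_detectProb hc, ENNReal.ofReal_mul hs.1]
  have hexp : ∀ {l I s : ℝ}, 0 ≤ I → 0 ≤ s → expNeg l (ENNReal.ofReal (s * I)) =
      ENNReal.ofReal (Real.exp (-(s * (l * I)))) := fun {l I s} hI hs => by
    rw [expNeg, ENNReal.toReal_ofReal (mul_nonneg hs hI)]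
    ring_nf
  have hgm : ∀ c s, Measurable fun z => 1 - ENNReal.ofReal s * q.detectProb c z := fun c s =>
    measurable_const.sub ((hdm c).const_mul _)
  -- For a fixed timer value, the potential blockers act as Poisson processes thinned by `s`, which
  -- scales both means `N₁` and `N₂` by `s`.
  have hmain : ∀ s ∈ Icc (0 : ℝ) 1, ∑' i, ∫⁻ ω, B.indicator 1 (x i ω) *
      (infProd (fun j => 1 - ENNReal.ofReal s * q.detectProb c₁ (x j ω - x i ω)) *
      infProd (fun m => 1 - ENNReal.ofReal s * q.detectProb c₂ (y m ω - x i ω))) ∂P =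
      ENNReal.ofReal lam * volume B * ENNReal.ofReal (Real.exp (-(s * (N₁ + N₂)))) := by
    intro s hs
    have hcont : ∀ z ≠ 0, ContinuousAt (fun z => 1 - ENNReal.ofReal s * q.detectProb c₁ z) z :=
      fun z hz => ENNReal.Tendsto.sub tendsto_const_nhds (ENNReal.Tendsto.const_mul
        (q.continuousAt_detectProb c₁ hz) (.inr ENNReal.ofReal_ne_top)) (.inl ENNReal.one_ne_top)
    rw [← lintegral_tsum fun i => ?_]
    · rw [hx.lintegral_tsum_infProd_mul_infProd hy hxy hlam.le hlam'.le hB hB1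
        (g := fun z => 1 - ENNReal.ofReal s * q.detectProb c₁ z)
        (g' := fun z => 1 - ENNReal.ofReal s * q.detectProb c₂ z) (hgm _ _)
        (fun z => tsub_le_self) (by simp [q.detectProb_zero])
        hcont ((hsub hc₁0 hs).trans_ne ENNReal.ofReal_ne_top) (hgm _ _) (fun z => tsub_le_self)
        ((hsub hc₂0 hs).trans_ne ENNReal.ofReal_ne_top),
        hsub hc₁0 hs, hsub hc₂0 hs, hexp hI₁.le hs.1, hexp hI₂.le hs.1, ← hN₁, ← hN₂,
        ← ENNReal.ofReal_mul (Real.exp_pos _).le, ← Real.exp_add]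
      ring_nf
    · refine Measurable.aemeasurable (.mul ?_ (.mul ?_ ?_))
      · exact (measurable_one.indicator hB).comp (hx.measurable i)
      · exact measurable_infProd fun j => (hgm c₁ s).comp ((hx.measurable j).sub (hx.measurable i))
      · exact measurable_infProd fun j => (hgm c₂ s).comp ((hy.measurable j).sub (hx.measurable i))
  have hN : 0 < N₁ + N₂ := by
    rw [hN₁, hN₂]; positivity
  have hnum : ∫⁻ ω, ∑' i, (x i ⁻¹' B ∩ E i).indicator 1 ω ∂P =
      ENNReal.ofReal lam * volume B *
        ENNReal.ofReal ((1 - Real.exp (-N₁ - N₂)) / (N₁ + N₂)) := by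
    have hm : ∀ i, MeasurableSet (x i ⁻¹' B ∩ E i) := fun i =>
      (hx.measurable i hB).inter (hacc i).1
    rw [lintegral_tsum fun i => (measurable_one.indicator (hm i)).aemeasurable]
    simp_rw [fun i => lintegral_indicator_one (μ := P) (hm i), fun i => (hacc i).2]
    -- The sum over points goes inside the timer integral, so that the Mecke formula applies at each
    -- `s`.
    rw [← lintegral_tsum fun i => ?_, setLIntegral_congr_fun measurableSet_Icc hmain,
      lintegral_const_mul' _ _ (ENNReal.mul_ne_top ENNReal.ofReal_ne_top hB1),
      lintegral_Icc_exp_neg_mul hN]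
    · ring_nf
    · refine (Measurable.lintegral_prod_right' (f := fun p : ℝ × Ω => B.indicator 1 (x i p.2) *
        (infProd (fun j => 1 - ENNReal.ofReal p.1 * q.detectProb c₁ (x j p.2 - x i p.2)) *
        infProd (fun m => 1 - ENNReal.ofReal p.1 * q.detectProb c₂ (y m p.2 - x i p.2))))
        ?_).aemeasurable
      refine Measurable.mul (((measurable_one.indicator hB).comp (hx.measurable i)).comp
        measurable_snd) (.mul ?_ ?_)
      · exact measurable_infProd fun j => measurable_const.sub
          ((ENNReal.measurable_ofReal.comp measurable_fst).mul
            ((hdm _).comp (((hx.measurable j).sub (hx.measurable i)).comp measurable_snd)))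
      · exact measurable_infProd fun j => measurable_const.sub
          ((ENNReal.measurable_ofReal.comp measurable_fst).mul
            ((hdm _).comp (((hy.measurable j).sub (hx.measurable i)).comp measurable_snd)))
  rw [palmProb, hnum, mul_comm]
  exact ENNReal.mul_div_cancel_right (mul_ne_zero (ENNReal.ofReal_pos.2 hlam).ne' hB0)
    (ENNReal.mul_ne_top ENNReal.ofReal_ne_top hB1)

end Access

end

theorem mainTheorem4 {Ω : Type*} [MeasurableSpace Ω] (P : Measure Ω) [IsProbabilityMeasure P]
    (q : Params) (net : Network Ω) (hnet : IsLBTModel P q 0 1 net)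
    (B : Set Plane) (hB : MeasurableSet B) (hB0 : volume B ≠ 0) (hB1 : volume B ≠ ∞) :
    palmProb P net.x q.lamW (accessW q net) B =
        ENNReal.ofReal ((1 - Real.exp (-q.NW - q.NL)) / (q.NW + q.NL)) ∧
      palmProb P net.y q.lamL (accessL q net) B =
        ENNReal.ofReal ((1 - Real.exp (-q.NW3 q.ΓL - q.NL3 q.ΓL)) / (q.NW3 q.ΓL + q.NL3 q.ΓL)) := by
  constructor
  · refine palmProb_access q q.lamW_pos q.lamL_pos hnet.ppp_x hnet.ppp_y hnet.indep_xy
      hnet.measurable_mark hnet.iIndep_mark hnet.indep_points_mark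
      (t := Sum.elim Mark.timerW Mark.timerL)
      (g := fun i => Sum.elim (fun j => Mark.fadeW j i) fun m => Mark.fadeLW m i)
      (fun i => ?_) ?_ (fun i => ?_) q.Γcs_pos q.PW_pos q.Γed_pos q.PL_pos hB hB0 hB1
      (fun i => rfl) (q.NW3_eq q.Γcs) (q.NL3_eq q.Γed)
    · rintro ((a | a) | (a | a)) ((b | b) | (b | b)) h <;> simp_all
    · rintro (k | k)
      exacts [hnet.timerW_law k, hnet.timerL_law k]
    · rintro (k | k)
      exacts [hnet.fadeW_law k i, hnet.fadeLW_law k i]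
  -- The same result with the two processes exchanged; both kinds of transmitter now face the
  -- threshold `q.ΓL`.
  · have hswap := palmProb_access q q.lamL_pos q.lamW_pos hnet.ppp_y hnet.ppp_x hnet.indep_xy.symm
      hnet.measurable_mark hnet.iIndep_mark
      (hnet.indep_points_mark.comp measurable_swap measurable_id)
      (t := Sum.elim Mark.timerL Mark.timerW)
      (g := fun k => Sum.elim (fun m => Mark.fadeL m k) fun j => Mark.fadeWL j k)
      (fun i => ?_) ?_ (fun i => ?_) q.ΓL_pos q.PL_pos q.ΓL_pos q.PW_pos hB hB0 hB1
      (E := accessL q net) (fun k => ?_) (q.NL3_eq q.ΓL) (q.NW3_eq q.ΓL)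
    · rw [hswap, add_comm (q.NL3 q.ΓL), neg_sub_comm]
    · rintro ((a | a) | (a | a)) ((b | b) | (b | b)) h <;> simp_all
    · rintro (k | k)
      exacts [hnet.timerL_law k, hnet.timerW_law k]
    · rintro (k | k)
      exacts [hnet.fadeL_law k i, hnet.fadeWL_law k i]
    · ext ω
      exact and_comm
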